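/- **Setting.** Let $\mathbb T=\mathbb R/\mathbb Z$, let $\|\cdot\|$ denote the usual metrics on $\mathbb T$ and $\mathbb T^2$, and call a homeomorphism minimal if each of its two-sided orbits is dense. Fix a minimal rotation $T(x,y)=(x+a,y+b)$ of $\mathbb T^2$ and $z_0\in\mathbb T^2$. Put $z_{2n}=(x_{2n},y_{2n})=T^nz_0$ and $z_{2n+1}=(x_{2n+1},y_{2n+1})=T^{-n-1}z_0$ for $n\ge 0$, let $\sigma,\tau$ be the bijections of $\mathbb N=\{0,1,\dots\}$ with $Tz_n=z_{\sigma(n)}$, $T^{-1}z_n=z_{\tau(n)}$, and let $X=(\mathbb T\setminus\{x_n\}_n)\times\mathbb T$. Fix also $1=\epsilon_0>\epsilon_1>\cdots\to0$, divisions $\epsilon_{k+1}=c_k^0<c_k^1<c_k^2<c_k^3<c_k^4=\epsilon_k$, and a sequence $(q_k)$ in $[0,1]$ dense in $[0,1]$. For $\alpha\in[0,1]^{\mathbb N}$ let $p_\alpha:(0,1]\to\mathbb R$ be the continuous function with $p_\alpha(1)=-\tfrac14$ which is affine on every $[c_k^{i},c_k^{i+1}]$ ($0\le i\le3$), equals $\alpha(k)/4$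 on $[c_k^0,c_k^1]$ and $q_k/4$ on $[c_k^2,c_k^3]$ if $k\ge1$, and equals $q_0/4$ on $[c_0^0,c_0^1]$ and $\alpha(0)/4$ on $[c_0^2,c_0^3]$. For $0<|t|\le 1$ let $h^\alpha_t:[-1,1]\to[-1,1]$ be the polyline through $(-1,-1)$, $(\frac{-1-|t|}2,-|t|)$, $(-\frac12,-\frac{|t|}2)$, $(-p_\alpha(|t|),\frac{|t|}4)$, $(\frac12,\frac{|t|}2)$, $(\frac{1+|t|}2,|t|)$, $(1,1)$, and let $h^\alpha_0$ be the polyline through $(-1,-1),(-\frac12,0),(\frac12,0),(1,1)$. Given positive reals $\delta_n<2^{-n}$, let $A_n$ be the closed square with centre $z_n$ and half-side $\delta_n$, let $\Lambda_n$ be the identity off $A_n$ and $$\Lambda_n(z_n+(t,s))=z_n+\bigl(t,\;h^\alpha_t\bigl((h^\alpha_{\delta_n})^{-1}(s)\bigr)\bigr)\qquad(|t|,|s|\le\delta_n),$$ and let $\Phi_n=\Lambda_n\circ\cdots\circ\Lambda_0$, $\Phi^\sigma_n=\Lambda_{\sigma(n)}\circ\cdots\circ\Lambda_{\sigma(0)}$,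 $\Phi^\tau_n=\Lambda_{\tau(n)}\circ\cdots\circ\Lambda_{\tau(0)}$. Call $(\delta_n)$ *admissible* for $\alpha$ if: 1. $A_m\cap A_n=\emptyset$ whenever $0<|m-n|\le5$; 2. for all $m<n$: $A_n\cap(\{x_m\}\times\mathbb T)=\emptyset$ and $\delta_n<\|x_m-x_n\|/n$; 3. for all $n\ge1$ and $u,v\in\{x_n\}\times\mathbb T$: $\|\Phi_{n-1}(u)-\Phi_{n-1}(v)\|\le\delta_n$ implies $\|u-v\|<1/n$; 4. there are integers $a_n\ge2$ with $\prod_{n\ge1}(1-1/a_n)>0$ such that for all $1\le n<m$ and $u,v\in\mathbb T^2$ with $\|u-v\|\ge1/n$, $\|\Phi_m(u)-\Phi_m(v)\|\ge\prod_{r=n+1}^m(1-1/a_r)\,\|\Phi_n(u)-\Phi_n(v)\|$; 5. the maps $(\Phi^\sigma_n)^{-1}\circ T\circ\Phi_n$ and $(\Phi^\tau_n)^{-1}\circ T^{-1}\circ\Phi_n$ of $X$ are uniformly continuous on $X$, and both sequences are uniformly Cauchy on $X$. **Statement.** Let $\alpha\in[0,1]^{\mathbb N}$. Admissible sequences for $\alpha$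 exist. For every admissible sequence, $\Phi_n$ converges uniformly to a continuous surjection $\Phi_\alpha:\mathbb T^2\to\mathbb T^2$ which restricts to a bijection of $X$, and $\Phi_\alpha^{-1}(\{w\})$ is a singleton if and only if $w\notin\{z_n\}_n$. The map $\Phi_\alpha^{-1}\circ T\circ\Phi_\alpha$ on $X$ has a unique continuous extension $S_\alpha:\mathbb T^2\to\mathbb T^2$; it is a homeomorphism of $\mathbb T^2$ with $\Phi_\alpha\circ S_\alpha=T\circ\Phi_\alpha$, so that $S_\alpha$ is an almost one-to-one extension of $T$; and $S_\alpha$ is minimal. -/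

import Mathlib

open Set Filter Topology

noncomputable section

namespace TorusMinimal

/-- The torus `𝕋² = (ℝ/ℤ) × (ℝ/ℤ)`. -/
abbrev Torus : Type := UnitAddCircle × UnitAddCircle

/-- The usual (flat, Euclidean) metric of the torus. -/
def torusDist (p q : Torus) : ℝ := Real.sqrt (dist p.1 q.1 ^ 2 + dist p.2 q.2 ^ 2)

/-- A homeomorphism is minimal if every (two-sided) orbit is dense. -/
def IsMinimalHomeo {X : Type*} [TopologicalSpace X] (f : X ≃ₜ X) : Prop :=
  ∀ p : X, Dense (range fun n : ℤ => (f ^ n) p)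

/-- The rotation `(x, y) ↦ (x + a, y + b)`. -/
def rotation (a b : UnitAddCircle) : Torus ≃ₜ Torus := Homeomorph.addRight ((a, b) : Torus)

/-- The choices that are fixed once and for all, before `α` is given. -/
structure Choices where
  /-- the rotation vector `(a, b)` of the minimal rotation `T` -/
  a : UnitAddCircle
  b : UnitAddCircle
  minimal_rotation : IsMinimalHomeo (rotation a b)
  /-- the base point of the distinguished `T`-orbit -/
  z₀ : Torus
  /-- the sequence `1 = ε₀ > ε₁ > ε₂ > ⋯ → 0` -/
  ε : ℕ → ℝ
  ε_zero : ε 0 = 1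
  ε_pos : ∀ n, 0 < ε n
  ε_anti : StrictAnti ε
  ε_lim : Tendsto ε atTop (𝓝 0)
  /-- the division `ε_{k+1} = c k 0 < c k 1 < c k 2 < c k 3 < c k 4 = ε_k` of `[ε_{k+1}, ε_k]`
  into four intervals -/
  c : ℕ → Fin 5 → ℝ
  c_mono : ∀ k, StrictMono (c k)
  c_zero : ∀ k, c k 0 = ε (k + 1)
  c_four : ∀ k, c k 4 = ε k
  /-- the dense sequence in `[0,1]` -/
  q : ℕ → ℝ
  q_mem : ∀ n, q n ∈ Icc (0 : ℝ) 1
  q_dense : Icc (0 : ℝ) 1 ⊆ closure (range q)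

/-- The polyline (piecewise affine function) through a list of vertices with increasing
abscissae. -/
def polyline : List (ℝ × ℝ) → ℝ → ℝ
  | [], _ => 0
  | [v], _ => v.2
  | v :: w :: l, s =>
      if s ≤ w.1 then v.2 + (s - v.1) * ((w.2 - v.2) / (w.1 - v.1)) else polyline (w :: l) s

/-- The bijection of `ℕ` with `T z_n = z_{σ n}`: `2k ↦ 2k+2`, `1 ↦ 0`, `2k+3 ↦ 2k+1`. -/
def sigma (n : ℕ) : ℕ := if n % 2 = 0 then n + 2 else if n = 1 then 0 else n - 2

/-- The bijection of `ℕ` with `T⁻¹ z_n = z_{τ n}`: `0 ↦ 1`, `2k+2 ↦ 2k`, `2k+1 ↦ 2k+3`. -/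
def tau (n : ℕ) : ℕ := if n = 0 then 1 else if n % 2 = 0 then n - 2 else n + 2

/-- The representative in `[-1/2, 1/2)` of a point of the circle. -/
def rep (u : UnitAddCircle) : ℝ := (AddCircle.equivIco (1 : ℝ) (-1 / 2) u : ℝ)

/-- `iter L n = L n ∘ L (n-1) ∘ ⋯ ∘ L 0`. -/
def iter (L : ℕ → Torus → Torus) : ℕ → Torus → Torus
  | 0 => L 0
  | n + 1 => L (n + 1) ∘ iter L n

namespace Choices

variable (D : Choices)

/-- The minimal rotation `T`. -/
def T : Torus ≃ₜ Torus := rotation D.a D.b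

/-- The enumeration `z_{2k} = T^k z₀`, `z_{2k+1} = T^{-k-1} z₀` of the orbit of `z₀`. -/
def z (n : ℕ) : Torus :=
  if n % 2 = 0 then (D.T ^ ((n / 2 : ℕ) : ℤ)) D.z₀ else (D.T ^ (-((n / 2 : ℕ) : ℤ) - 1)) D.z₀

/-- The `T`-invariant comeager set `X = (𝕋 \ {x_n}) × 𝕋`. -/
def X : Set Torus := {p | ∀ n, p.1 ≠ (D.z n).1}

/-- Four times the value of `p_α` on the first of the four parts of `[ε_{k+1}, ε_k]`. -/
def lowVal (α : ℕ → ℝ) (k : ℕ) : ℝ := if k = 0 then D.q 0 else α k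

/-- Four times the value of `p_α` on the third of the four parts of `[ε_{k+1}, ε_k]`. -/
def highVal (α : ℕ → ℝ) (k : ℕ) : ℝ := if k = 0 then α 0 else D.q k

/-- Four times the value of `p_α` at `ε_k`; at `ε₀ = 1` it is the value that makes
`h_1` the identity. -/
def endVal (α : ℕ → ℝ) : ℕ → ℝ
  | 0 => -1
  | k + 1 => D.lowVal α k

/-- The continuous function `p_α` on `(0,1]`: on `[ε_{k+1}, ε_k]` it is constant on the first
and on the third of the four parts and affine on the second and on the fourth. For `0 < t ≤ 1`
the index `k` below is the one with `ε_{k+1} < t ≤ ε_k`. -/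
def p (α : ℕ → ℝ) (t : ℝ) : ℝ :=
  let k := sInf {k : ℕ | D.ε (k + 1) < t}
  polyline
    [(D.c k 0, D.lowVal α k / 4), (D.c k 1, D.lowVal α k / 4),
     (D.c k 2, D.highVal α k / 4), (D.c k 3, D.highVal α k / 4),
     (D.c k 4, D.endVal α k / 4)] t

/-- The function `h^α_t(s)` on `[-1,1]²`, with `h^α_{-t} = h^α_t`. -/
def h (α : ℕ → ℝ) (t s : ℝ) : ℝ :=
  if t = 0 then polyline [(-1, -1), (-1 / 2, 0), (1 / 2, 0), (1, 1)] s
  else polyline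
    [(-1, -1), ((-1 - |t|) / 2, -|t|), (-1 / 2, -|t| / 2), (-D.p α |t|, |t| / 4),
     (1 / 2, |t| / 2), ((1 + |t|) / 2, |t|), (1, 1)] s

/-- The inverse of `h^α_t : [-1,1] → [-1,1]` (used for `t ≠ 0`). -/
def hInv (α : ℕ → ℝ) (t : ℝ) : ℝ → ℝ := Function.invFunOn (D.h α t) (Icc (-1) 1)

/-- The closed square `A_n` with centre `z_n` and half-side `δ_n`. -/
def A (δ : ℕ → ℝ) (n : ℕ) : Set Torus :=
  {u | |rep (u.1 - (D.z n).1)| ≤ δ n ∧ |rep (u.2 - (D.z n).2)| ≤ δ n}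

open Classical in
/-- `Λ_{α,n}(z_n + (t, s)) = z_n + (t, h^α_t((h^α_{δ_n})⁻¹(s)))` on `A_n`, the identity
elsewhere. -/
def Lam (α δ : ℕ → ℝ) (n : ℕ) (u : Torus) : Torus :=
  if u ∈ D.A δ n then
    (u.1, (D.z n).2 +
      ((D.h α (rep (u.1 - (D.z n).1)) (D.hInv α (δ n) (rep (u.2 - (D.z n).2))) : ℝ) :
        UnitAddCircle))
  else u

/-- `Φ_{α,n} = Λ_{α,n} ∘ ⋯ ∘ Λ_{α,0}`. -/
def Phi (α δ : ℕ → ℝ) : ℕ → Torus → Torus := iter (D.Lam α δ)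

/-- `Φ^σ_{α,n} = Λ_{α,σ(n)} ∘ ⋯ ∘ Λ_{α,σ(0)}`. -/
def PhiSigma (α δ : ℕ → ℝ) : ℕ → Torus → Torus := iter fun k => D.Lam α δ (sigma k)

/-- `Φ^τ_{α,n} = Λ_{α,τ(n)} ∘ ⋯ ∘ Λ_{α,τ(0)}`. -/
def PhiTau (α δ : ℕ → ℝ) : ℕ → Torus → Torus := iter fun k => D.Lam α δ (tau k)

/-- `(Φ^σ_{α,n})⁻¹ ∘ T ∘ Φ_{α,n}` on `X`. -/
def Gam (α δ : ℕ → ℝ) (n : ℕ) (u : Torus) : Torus :=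
  Function.invFunOn (D.PhiSigma α δ n) D.X (D.T (D.Phi α δ n u))

/-- `(Φ^τ_{α,n})⁻¹ ∘ T⁻¹ ∘ Φ_{α,n}` on `X`. -/
def Del (α δ : ℕ → ℝ) (n : ℕ) (u : Torus) : Torus :=
  Function.invFunOn (D.PhiTau α δ n) D.X (D.T.symm (D.Phi α δ n u))

/-- The requirements on the sizes `δ_n = δ_{α,n}` of the squares. -/
structure Admissible (α δ : ℕ → ℝ) : Prop where
  pos : ∀ n, 0 < δ n
  disjoint : ∀ m n, m < n → n ≤ m + 5 → Disjoint (D.A δ m) (D.A δ n)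
  lt_pow : ∀ n, δ n < 1 / 2 ^ n
  avoid : ∀ m n, m < n → ∀ u ∈ D.A δ n, u.1 ≠ (D.z m).1
  lt_dist : ∀ m n, m < n → δ n < dist (D.z m).1 (D.z n).1 / n
  fibre : ∀ n, ∀ v w : UnitAddCircle,
    torusDist (D.Phi α δ n ((D.z (n + 1)).1, v)) (D.Phi α δ n ((D.z (n + 1)).1, w)) ≤ δ (n + 1) →
      dist v w < 1 / ((n + 1 : ℕ) : ℝ)
  expand : ∃ a : ℕ → ℕ, (∀ n, 2 ≤ a n) ∧
    (∃ C : ℝ, 0 < C ∧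
      Tendsto (fun N : ℕ => ∏ r ∈ Finset.Icc 1 N, (1 - 1 / (a r : ℝ))) atTop (𝓝 C)) ∧
    ∀ n m : ℕ, 1 ≤ n → n < m → ∀ u v : Torus, 1 / (n : ℝ) ≤ torusDist u v →
      (∏ r ∈ Finset.Icc (n + 1) m, (1 - 1 / (a r : ℝ))) *
          torusDist (D.Phi α δ n u) (D.Phi α δ n v)
        ≤ torusDist (D.Phi α δ m u) (D.Phi α δ m v)
  gam_unifCont : ∀ n, UniformContinuousOn (D.Gam α δ n) D.X
  del_unifCont : ∀ n, UniformContinuousOn (D.Del α δ n) D.X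
  gam_cauchy : UniformCauchySeqOn (D.Gam α δ) atTop D.X
  del_cauchy : UniformCauchySeqOn (D.Del α δ) atTop D.X

/-- `S` agrees on `X` with `Φ⁻¹ ∘ T ∘ Φ`, where `Φ` is inverted as a self-map of `X`. -/
def Extends (Φ S : Torus → Torus) : Prop :=
  ∀ u ∈ D.X, S u = Function.invFunOn Φ D.X (D.T (Φ u))

end Choices

end TorusMinimal

end

open TorusMinimal

/-! Every `Lam` moves points only vertically and only inside its square. It is injective except on
the fibre of its centre `z n`, where a vertical interval collapses to `z n`. Displacements are at
most `2 * δ n`, hence summable, so the products `Phi` converge uniformly, and the limit is onto by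
compactness. If two points have the same limit image, the expansion condition makes their images
coincide at a finite stage. Finite products fail to be injective only over points `z m`, and these
are fixed by all later factors (`limit_eq`). Conversely, each `z n` keeps two preimages. So the
limit is injective over `X`.

To lift the rotation, write Γ_n for the inverse of the reordered product, after the rotation, after
`Phi n`, on `X`. Near a singular fibre the singular factor can be moved to the front of both
products (`eventually_PhiPerm_eq`). The two singular factors share the same `h t`, which cancels and
leaves a continuous map (`exists_Lam_conj`). Hence Γ_n extends continuously to the torus. A
uniformly Cauchy sequence of such maps has a continuous limit S. The reordered products differ from
`Phi` by a single factor at suitable indices (`PhiPerm_zigzag`), so in the limit Φ ∘ S = T ∘ Φ. The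
inverse rotation is lifted likewise, and the two lifts are inverse to each other because Φ is
injective on the dense set `X`. For minimality, Φ maps an orbit closure of S onto the torus, so that
closure contains `X`.

Admissible sizes are chosen recursively: each requirement holds for every sufficiently small next
size. The key fact is that for k < j the point `z j` has exactly one preimage under `Phi k`, so
small balls about it have small preimages. This controls both the expansion (`expand_succ`) and the
difference of consecutive Γ_n (`dist_GamPerm_succ_le`). -/

noncomputable section

namespace TorusMinimal

/-! ### Polylines: monotonicity, values at vertices, continuity. -/

/-- Both coordinates increase strictly. -/
def StepUp (v w : ℝ × ℝ) : Prop := v.1 < w.1 ∧ v.2 < w.2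

lemma polyline_head {v : ℝ × ℝ} {l : List (ℝ × ℝ)} (hl : (v :: l).IsChain (fun v w => v.1 < w.1)) :
    polyline (v :: l) v.1 = v.2 := by
  cases l with
  | nil => rfl
  | cons w l =>
    rw [List.isChain_cons_cons] at hl
    simp [polyline, hl.1.le]

lemma polyline_second {v w : ℝ × ℝ} {l : List (ℝ × ℝ)} (h : v.1 < w.1) :
    polyline (v :: w :: l) w.1 = w.2 := by
  have : w.1 - v.1 ≠ 0 := by linarith
  simp only [polyline, le_refl, if_true]
  field_simp
  ring

lemma polyline_of_le {v w : ℝ × ℝ} {l : List (ℝ × ℝ)}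
    (hl : (v :: w :: l).IsChain (fun v w => v.1 < w.1)) {s : ℝ} (hs : w.1 ≤ s) :
    polyline (v :: w :: l) s = polyline (w :: l) s := by
  rw [List.isChain_cons_cons] at hl
  rcases hs.eq_or_lt with rfl | hs
  · rw [polyline_second hl.1, polyline_head hl.2]
  · simp [polyline, not_le.2 hs]

lemma head_le_getLast {v : ℝ × ℝ} {l : List (ℝ × ℝ)}
    (hl : (v :: l).IsChain StepUp) :
    v.1 ≤ ((v :: l).getLast (by simp)).1 := by
  induction l generalizing v with
  | nil => simp
  | cons w l ih =>
    rw [List.isChain_cons_cons] at hl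
    rw [List.getLast_cons_cons]
    exact hl.1.1.le.trans (ih hl.2)

lemma chain_fst {l : List (ℝ × ℝ)} (hl : l.IsChain StepUp) :
    l.IsChain (fun v w => v.1 < w.1) := hl.imp fun _ _ h => h.1

lemma polyline_strictMonoOn {v : ℝ × ℝ} {l : List (ℝ × ℝ)}
    (hl : (v :: l).IsChain StepUp) :
    StrictMonoOn (polyline (v :: l)) (Icc v.1 ((v :: l).getLast (by simp)).1) := by
  induction l generalizing v with
  | nil => intro x hx y hy hxy; simp at hx hy; linarith
  | cons w l ih =>
    have hl' := List.isChain_cons_cons.1 hl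
    rw [List.getLast_cons_cons, ← Icc_union_Icc_eq_Icc hl'.1.1.le (head_le_getLast hl'.2)]
    have h1 : StrictMonoOn (polyline (v :: w :: l)) (Icc v.1 w.1) := by
      intro x hx y hy hxy
      have : 0 < (w.2 - v.2) / (w.1 - v.1) :=
        div_pos (sub_pos.2 hl'.1.2) (sub_pos.2 hl'.1.1)
      simp only [polyline, hx.2, hy.2, if_true]
      nlinarith
    have h2 : StrictMonoOn (polyline (v :: w :: l))
        (Icc w.1 ((w :: l).getLast (by simp)).1) :=
      (ih hl'.2).congr fun s hs => (polyline_of_le (chain_fst hl) hs.1).symm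
    exact h1.union h2 (isGreatest_Icc hl'.1.1.le) (isLeast_Icc (head_le_getLast hl'.2))

lemma polyline_vertex {l : List (ℝ × ℝ)} (hl : l.IsChain StepUp) {v : ℝ × ℝ} (hv : v ∈ l) :
    polyline l v.1 = v.2 := by
  induction l with
  | nil => simp at hv
  | cons w l ih =>
    rcases List.mem_cons.1 hv with rfl | hv'
    · exact polyline_head (chain_fst hl)
    · cases l with
      | nil => simp at hv'
      | cons u l =>
        have hl' := List.isChain_cons_cons.1 hl
        rw [polyline_of_le (chain_fst hl), ih hl'.2 hv']
        rcases List.mem_cons.1 hv' with rfl | hv''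
        · exact le_rfl
        · have : IsTrans (ℝ × ℝ) StepUp := ⟨fun a b c h k => ⟨h.1.trans k.1, h.2.trans k.2⟩⟩
          exact ((List.pairwise_cons.1 (List.isChain_iff_pairwise.1 hl'.2)).1 v hv'').1.le

/-- The vertices may depend on a parameter, because `h` is needed as a jointly continuous function
of `t` and `s`. Adjacent pieces agree at the common vertex, so they glue. -/
lemma continuous_polyline {P : Type*} [TopologicalSpace P] {l : List (P → ℝ × ℝ)}
    (hl : ∀ p, (l.map fun f => f p).IsChain (fun v w => v.1 < w.1)) (hc : ∀ f ∈ l, Continuous f) :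
    Continuous fun q : P × ℝ => polyline (l.map fun f => f q.1) q.2 := by
  induction l with
  | nil => simpa [polyline] using continuous_const
  | cons f l ih =>
    cases l with
    | nil =>
      have := hc f (by simp)
      simp only [List.map_cons, List.map_nil, polyline]
      fun_prop
    | cons g l =>
      have hf := hc f (by simp)
      have hg := hc g (by simp)
      have hl' := fun p => List.isChain_cons_cons.1 (hl p)
      have ih' := ih (fun p => (hl' p).2) fun k hk => hc k (by simp [hk])
      simp only [List.map_cons, polyline] at ih' ⊢
      refine Continuous.if_le ?_ ih' continuous_snd (by fun_prop) ?_
      · have : ∀ q : P × ℝ, (g q.1).1 - (f q.1).1 ≠ 0 := fun q => (sub_pos.2 (hl' q.1).1).ne'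
        fun_prop (disch := assumption)
      · intro q hq
        have h1 := polyline_second (l := l.map fun f => f q.1) (hl' q.1).1
        have h2 := polyline_head (hl' q.1).2
        simp only [polyline, le_refl, if_true, ← hq] at h1 h2 ⊢
        rw [h1, ← h2]

/-! ### The profile `p`. -/

namespace Choices
variable (D : Choices) {α : ℕ → ℝ}

lemma lowVal_mem (hα : ∀ n, α n ∈ Icc (0 : ℝ) 1) (k : ℕ) : D.lowVal α k ∈ Icc (0 : ℝ) 1 := by
  unfold lowVal; split_ifs
  exacts [D.q_mem 0, hα k]

lemma highVal_mem (hα : ∀ n, α n ∈ Icc (0 : ℝ) 1) (k : ℕ) : D.highVal α k ∈ Icc (0 : ℝ) 1 := by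
  unfold highVal; split_ifs
  exacts [hα 0, D.q_mem k]

lemma endVal_mem (hα : ∀ n, α n ∈ Icc (0 : ℝ) 1) (k : ℕ) : D.endVal α k ∈ Icc (-1 : ℝ) 1 := by
  cases k with
  | zero => simp [endVal]
  | succ k => exact ⟨neg_one_lt_zero.le.trans (D.lowVal_mem hα k).1, (D.lowVal_mem hα k).2⟩

/-- The vertices of `p_α` over `[ε_{k+1}, ε_k]`. -/
def pVertices (α : ℕ → ℝ) (k : ℕ) : List (ℝ × ℝ) :=
  [(D.c k 0, D.lowVal α k / 4), (D.c k 1, D.lowVal α k / 4),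
     (D.c k 2, D.highVal α k / 4), (D.c k 3, D.highVal α k / 4),
     (D.c k 4, D.endVal α k / 4)]

lemma c_lt (k : ℕ) : D.c k 0 < D.c k 1 ∧ D.c k 1 < D.c k 2 ∧ D.c k 2 < D.c k 3 ∧
    D.c k 3 < D.c k 4 := by
  refine ⟨?_, ?_, ?_, ?_⟩ <;> exact D.c_mono k (by decide)

lemma pVertices_chain (k : ℕ) : (D.pVertices α k).IsChain (fun v w => v.1 < w.1) := by
  simpa [pVertices] using D.c_lt k

lemma p_eq {k : ℕ} {t : ℝ} (h1 : D.ε (k + 1) < t) (h2 : t ≤ D.ε k) :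
    D.p α t = polyline (D.pVertices α k) t := by
  have : sInf {k : ℕ | D.ε (k + 1) < t} = k := by
    apply le_antisymm (Nat.sInf_le h1)
    apply le_csInf ⟨k, h1⟩
    intro j hj
    by_contra! h
    have : D.ε k ≤ D.ε (j + 1) := D.ε_anti.antitone h
    have : D.ε (j + 1) < t := hj
    linarith
  simp only [p, this, pVertices]

lemma polyline_pVertices_left (k : ℕ) :
    polyline (D.pVertices α k) (D.ε (k + 1)) = D.lowVal α k / 4 := by
  rw [← D.c_zero k]
  exact polyline_head (D.pVertices_chain k)

lemma polyline_pVertices_right (k : ℕ) :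
    polyline (D.pVertices α k) (D.ε k) = D.endVal α k / 4 := by
  rw [← D.c_four k]
  obtain ⟨h0, h1, h2, h3⟩ := D.c_lt k
  have h5 : D.c k 4 - D.c k 3 ≠ 0 := by linarith
  have e1 : ¬ D.c k 4 ≤ D.c k 1 := by linarith
  have e2 : ¬ D.c k 4 ≤ D.c k 2 := by linarith
  have e3 : ¬ D.c k 4 ≤ D.c k 3 := by linarith
  simp only [pVertices, polyline, e1, e2, e3, if_false, le_refl, if_true]
  field_simp
  ring

/-- The index in `p` belongs to intervals closed on the right. At their left end the neighbouring
piece has the same value, since `endVal (k + 1)` is `lowVal k`; this gives continuity from the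
right. -/
lemma p_eq_right {k : ℕ} {t : ℝ} (h1 : D.ε (k + 1) ≤ t) (h2 : t < D.ε k) :
    D.p α t = polyline (D.pVertices α k) t := by
  rcases h1.eq_or_lt with rfl | h1
  · rw [D.p_eq (D.ε_anti (Nat.lt_succ_self _)) le_rfl, D.polyline_pVertices_left,
      D.polyline_pVertices_right]
    rfl
  · exact D.p_eq h1 h2.le

lemma exists_eps_lt {t : ℝ} (h0 : 0 < t) : ∃ k, D.ε k < t :=
  (D.ε_lim.eventually (gt_mem_nhds h0)).exists

lemma exists_eps_left {t : ℝ} (h0 : 0 < t) (h1 : t ≤ 1) :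
    ∃ k, D.ε (k + 1) < t ∧ t ≤ D.ε k := by
  classical
  have h := D.exists_eps_lt h0
  have h2 : Nat.find h ≠ 0 := by
    intro h3
    have := Nat.find_spec h
    rw [h3, D.ε_zero] at this
    linarith
  obtain ⟨k, hk⟩ := Nat.exists_eq_succ_of_ne_zero h2
  refine ⟨k, ?_, ?_⟩
  · have := Nat.find_spec h
    rwa [hk] at this
  · exact not_lt.1 (Nat.find_min h (m := k) (by omega))

lemma exists_eps_right {t : ℝ} (h0 : 0 < t) (h1 : t < 1) :
    ∃ k, D.ε (k + 1) ≤ t ∧ t < D.ε k := by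
  obtain ⟨k, hk1, hk2⟩ := D.exists_eps_left h0 h1.le
  rcases hk2.eq_or_lt with rfl | h
  · cases k with
    | zero => rw [D.ε_zero] at h1; linarith
    | succ k => exact ⟨k, le_rfl, D.ε_anti (Nat.lt_succ_self _)⟩
  · exact ⟨k, hk1.le, h⟩

lemma continuous_polyline_pVertices (k : ℕ) : Continuous (polyline (D.pVertices α k)) := by
  have := continuous_polyline (P := Unit) (l := (D.pVertices α k).map fun v _ => v)
    (by intro p; simpa [Function.comp_def] using D.pVertices_chain k) (by
      intro f hf
      obtain ⟨v, -, rfl⟩ := List.mem_map.1 hf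
      exact continuous_const)
  simpa [Function.comp_def] using this.comp (Continuous.prodMk_right ())

lemma continuousAt_p {t : ℝ} (h0 : 0 < t) (h1 : t < 1) : ContinuousAt (D.p α) t := by
  rw [continuousAt_iff_continuous_left_right]
  constructor
  · obtain ⟨k, hk1, hk2⟩ := D.exists_eps_left h0 h1.le
    refine (D.continuous_polyline_pVertices (α := α) k).continuousWithinAt.congr_of_eventuallyEq
      ?_ (D.p_eq hk1 hk2)
    filter_upwards [self_mem_nhdsWithin, mem_nhdsWithin_of_mem_nhds (lt_mem_nhds hk1)] with s hs hs'
    exact D.p_eq hs' (le_trans hs hk2)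
  · obtain ⟨k, hk1, hk2⟩ := D.exists_eps_right h0 h1
    refine (D.continuous_polyline_pVertices (α := α) k).continuousWithinAt.congr_of_eventuallyEq
      ?_ (D.p_eq_right hk1 hk2)
    filter_upwards [self_mem_nhdsWithin, mem_nhdsWithin_of_mem_nhds (gt_mem_nhds hk2)] with s hs hs'
    exact D.p_eq_right (le_trans hk1 hs) hs'

end Choices

lemma affine_mem_Icc {a b x y u v s : ℝ} (hxy : x < y) (hs : s ∈ Icc x y)
    (hu : u ∈ Icc a b) (hv : v ∈ Icc a b) : u + (s - x) * ((v - u) / (y - x)) ∈ Icc a b := by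
  have hd : 0 < y - x := by linarith
  set r := (s - x) / (y - x) with hr
  have hr0 : 0 ≤ r := div_nonneg (by linarith [hs.1]) hd.le
  have hr1 : r ≤ 1 := (div_le_one hd).2 (by linarith [hs.2])
  have : u + (s - x) * ((v - u) / (y - x)) = u + r * (v - u) := by rw [hr]; ring
  rw [this]
  constructor <;> nlinarith [hu.1, hu.2, hv.1, hv.2]

/-- No upper bound on `s` is needed: beyond its last vertex a polyline is constant. -/
lemma polyline_mem_Icc {a b : ℝ} {v : ℝ × ℝ} {l : List (ℝ × ℝ)}
    (hl : (v :: l).IsChain (fun v w => v.1 < w.1)) (hb : ∀ w ∈ v :: l, w.2 ∈ Icc a b) {s : ℝ}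
    (hs : v.1 ≤ s) : polyline (v :: l) s ∈ Icc a b := by
  induction l generalizing v with
  | nil => exact hb v (by simp)
  | cons w l ih =>
    have hl' := List.isChain_cons_cons.1 hl
    rcases le_total s w.1 with h | h
    · simp only [polyline, h, if_true]
      exact affine_mem_Icc hl'.1 ⟨hs, h⟩ (hb v (by simp)) (hb w (by simp))
    · rw [polyline_of_le hl h]
      exact ih hl'.2 (fun u hu => hb u (by simp [hu])) h

namespace Choices
variable (D : Choices) {α : ℕ → ℝ}

/-- The bound keeps the abscissa `-p` of the middle vertex of `h` strictly between `-1/2` and `1/2`.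
-/
lemma p_mem (hα : ∀ n, α n ∈ Icc (0 : ℝ) 1) {t : ℝ} (h0 : 0 < t) (h1 : t ≤ 1) :
    D.p α t ∈ Icc (-(1 / 4) : ℝ) (1 / 4) := by
  obtain ⟨k, hk1, hk2⟩ := D.exists_eps_left h0 h1
  rw [D.p_eq hk1 hk2]
  refine polyline_mem_Icc (D.pVertices_chain k) ?_ (by rw [D.c_zero]; exact hk1.le)
  have h1 := D.lowVal_mem hα k
  have h2 := D.highVal_mem hα k
  have h3 := D.endVal_mem hα k
  simp only [mem_Icc] at h1 h2 h3
  simp only [List.forall_mem_cons, mem_Icc]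
  refine ⟨?_, ?_, ?_, ?_, ?_, by simp⟩ <;> constructor <;> linarith

end Choices

/-! ### The fibre maps `h` and their inverses. -/

namespace Choices
variable (D : Choices) {α : ℕ → ℝ}

/-- The vertices of `h^α_t` for `t > 0`. -/
def hVertices (α : ℕ → ℝ) (t : ℝ) : List (ℝ × ℝ) :=
  [(-1, -1), ((-1 - t) / 2, -t), (-1 / 2, -t / 2), (-D.p α t, t / 4),
     (1 / 2, t / 2), ((1 + t) / 2, t), (1, 1)]

lemma h_of_ne {t : ℝ} (ht : t ≠ 0) (s : ℝ) : D.h α t s = polyline (D.hVertices α |t|) s := by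
  simp [h, ht, hVertices]

lemma h_abs (t s : ℝ) : D.h α |t| s = D.h α t s := by
  simp [h]

lemma h_zero (s : ℝ) : D.h α 0 s =
    if s ≤ -1 / 2 then 2 * s + 1 else if s ≤ 1 / 2 then 0 else if s ≤ 1 then 2 * s - 1 else 1 := by
  simp only [h, if_true, polyline]
  split_ifs <;> ring

/-- At `t = 1` the first two vertices coincide, and so do the last two; hence the strict bound. -/
lemma hVertices_chain (hα : ∀ n, α n ∈ Icc (0 : ℝ) 1) {t : ℝ} (h0 : 0 < t) (h1 : t < 1) :
    (D.hVertices α t).IsChain StepUp := by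
  have hp := D.p_mem hα h0 h1.le
  simp only [mem_Icc] at hp
  simp only [hVertices, List.isChain_cons_cons, StepUp, List.IsChain.singleton, and_true]
  refine ⟨⟨?_, ?_⟩, ⟨?_, ?_⟩, ⟨?_, ?_⟩, ⟨?_, ?_⟩, ⟨?_, ?_⟩, ?_, ?_⟩ <;> linarith

lemma h_strictMonoOn (hα : ∀ n, α n ∈ Icc (0 : ℝ) 1) {t : ℝ} (h0 : t ≠ 0) (h1 : |t| < 1) :
    StrictMonoOn (D.h α t) (Icc (-1) 1) := by
  have := polyline_strictMonoOn (D.hVertices_chain hα (abs_pos.2 h0) h1)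
  refine this.congr fun s _ => (D.h_of_ne h0 s).symm

lemma h_vertex (hα : ∀ n, α n ∈ Icc (0 : ℝ) 1) {t : ℝ} (h0 : t ≠ 0) (h1 : |t| < 1) {x y : ℝ}
    (h : (x, y) ∈ D.hVertices α |t|) : D.h α t x = y := by
  rw [D.h_of_ne h0]
  exact polyline_vertex (D.hVertices_chain hα (abs_pos.2 h0) h1) h

/-- The outer segments lie on lines of slope 2 that do not depend on `t`. This is why `h t` after
the inverse of `h d` is the identity for `|s| ≥ max |t| d`. -/
lemma h_upper (hα : ∀ n, α n ∈ Icc (0 : ℝ) 1) {t : ℝ} (h1 : |t| < 1) {s : ℝ}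
    (hs : (1 + |t|) / 2 ≤ s) (hs1 : s ≤ 1) : D.h α t s = 2 * s - 1 := by
  by_cases h0 : t = 0
  · subst h0
    rw [h_zero]
    simp only [abs_zero] at hs
    split_ifs <;> linarith
  rcases hs.eq_or_lt with rfl | hs
  · rw [D.h_vertex hα h0 h1 (y := |t|) (by simp [hVertices])]; ring
  · have ht := abs_pos.2 h0
    have hp := D.p_mem hα ht h1.le
    simp only [mem_Icc] at hp
    rw [D.h_of_ne h0, hVertices]
    simp only [polyline]
    rw [if_neg (by linarith), if_neg (by linarith), if_neg (by linarith), if_neg (by linarith),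
      if_neg (by linarith), if_pos hs1]
    have : (1 - |t|) / (1 - (1 + |t|) / 2) = 2 := by
      rw [div_eq_iff (by linarith)]; ring
    rw [this]; ring

lemma h_lower {t : ℝ} (h1 : |t| < 1) {s : ℝ}
    (hs : s ≤ (-1 - |t|) / 2) : D.h α t s = 2 * s + 1 := by
  by_cases h0 : t = 0
  · subst h0
    rw [h_zero]
    simp only [abs_zero] at hs
    split_ifs <;> linarith
  · rw [D.h_of_ne h0, hVertices]
    simp only [polyline]
    rw [if_pos hs]
    have : (-|t| - -1) / ((-1 - |t|) / 2 - -1) = 2 := by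
      rw [div_eq_iff (by linarith)]; ring
    rw [this]; ring

lemma h_monotoneOn (hα : ∀ n, α n ∈ Icc (0 : ℝ) 1) {t : ℝ} (h1 : |t| < 1) :
    MonotoneOn (D.h α t) (Icc (-1) 1) := by
  by_cases h0 : t = 0
  · subst h0
    intro x hx y hy hxy
    simp only [mem_Icc] at hx hy
    rw [h_zero, h_zero]
    split_ifs <;> linarith
  · exact (D.h_strictMonoOn hα h0 h1).monotoneOn

/-- However `p` oscillates near 0, monotonicity confines `h t` on `[-1/2, 1/2]` to heights between
`-|t|/2` and `|t|/2`. So `h t` tends to `h 0` uniformly. -/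
lemma abs_h_sub_h_zero_le (hα : ∀ n, α n ∈ Icc (0 : ℝ) 1) {t : ℝ} (h1 : |t| < 1) {s : ℝ}
    (hs : s ∈ Icc (-1 : ℝ) 1) : |D.h α t s - D.h α 0 s| ≤ |t| := by
  by_cases h0 : t = 0
  · simp [h0]
  have ht := abs_pos.2 h0
  have hm := D.h_monotoneOn hα h1
  have v1 := D.h_vertex hα h0 h1 (x := (-1 - |t|) / 2) (y := -|t|) (by simp [hVertices])
  have v2 := D.h_vertex hα h0 h1 (x := -1 / 2) (y := -|t| / 2) (by simp [hVertices])
  have v3 := D.h_vertex hα h0 h1 (x := 1 / 2) (y := |t| / 2) (by simp [hVertices])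
  have v4 := D.h_vertex hα h0 h1 (x := (1 + |t|) / 2) (y := |t|) (by simp [hVertices])
  have m1 : (-1 - |t|) / 2 ∈ Icc (-1 : ℝ) 1 := ⟨by linarith, by linarith⟩
  have m2 : -1 / 2 ∈ Icc (-1 : ℝ) 1 := ⟨by norm_num, by norm_num⟩
  have m3 : 1 / 2 ∈ Icc (-1 : ℝ) 1 := ⟨by norm_num, by norm_num⟩
  have m4 : (1 + |t|) / 2 ∈ Icc (-1 : ℝ) 1 := ⟨by linarith, by linarith⟩
  rw [h_zero, abs_le]
  rcases le_total s ((-1 - |t|) / 2) with a1 | a1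
  · rw [D.h_lower h1 a1, if_pos (by linarith)]
    constructor <;> linarith
  rcases le_total ((1 + |t|) / 2) s with a4 | a4
  · rw [D.h_upper hα h1 a4 hs.2, if_neg (by linarith), if_neg (by linarith), if_pos hs.2]
    constructor <;> linarith
  have b1 := hm m1 hs a1
  have b4 := hm hs m4 a4
  split_ifs with c1 c2 c3
  · have := hm hs m2 c1
    constructor <;> linarith
  · have := hm m2 hs (not_le.1 c1).le
    have := hm hs m3 c2
    constructor <;> linarith
  · have := hm m3 hs (not_le.1 c2).le
    constructor <;> linarith
  · exact absurd hs.2 c3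

lemma continuous_h_zero : Continuous (D.h α 0) := by
  have : D.h α 0 = fun s =>
    if s ≤ -1 / 2 then 2 * s + 1 else if s ≤ 1 / 2 then 0 else if s ≤ 1 then 2 * s - 1 else 1 :=
    funext D.h_zero
  rw [this]
  refine Continuous.if_le (by fun_prop) (Continuous.if_le (by fun_prop) (Continuous.if_le
    (by fun_prop) (by fun_prop) continuous_id continuous_const ?_) continuous_id
      continuous_const ?_) continuous_id continuous_const ?_
  · rintro x rfl; norm_num
  · rintro x rfl; norm_num
  · rintro x rfl; norm_num

lemma continuousAt_h (hα : ∀ n, α n ∈ Icc (0 : ℝ) 1) {t : ℝ} (h0 : t ≠ 0) (h1 : |t| < 1) (s : ℝ) :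
    ContinuousAt (fun q : ℝ × ℝ => D.h α q.1 q.2) (t, s) := by
  have hp : Continuous fun t : Ioo (0 : ℝ) 1 => D.p α t :=
    continuousOn_iff_continuous_domRestrict.1
      fun t ht => (D.continuousAt_p ht.1 ht.2).continuousWithinAt
  have hc : Continuous fun q : Ioo (0 : ℝ) 1 × ℝ => polyline (D.hVertices α q.1) q.2 := by
    have := continuous_polyline (P := Ioo (0 : ℝ) 1) (l := [fun _ => (-1, -1),
      fun t => ((-1 - (t : ℝ)) / 2, -(t : ℝ)), fun t => (-1 / 2, -(t : ℝ) / 2),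
      fun t => (-D.p α t, (t : ℝ) / 4), fun t => (1 / 2, (t : ℝ) / 2),
      fun t => ((1 + (t : ℝ)) / 2, (t : ℝ)), fun _ => (1, 1)])
      (fun t => chain_fst (D.hVertices_chain hα t.2.1 t.2.2)) (by
        simp only [List.forall_mem_cons]
        refine ⟨?_, ?_, ?_, ?_, ?_, ?_, ?_, by simp⟩ <;> fun_prop)
    exact this
  have hU : IsOpen ({t : ℝ | t ≠ 0 ∧ |t| < 1}) :=
    isOpen_ne.inter (isOpen_lt continuous_abs continuous_const)
  have hcU : ContinuousOn (fun q : ℝ × ℝ => D.h α q.1 q.2)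
      ({t : ℝ | t ≠ 0 ∧ |t| < 1} ×ˢ univ) := by
    rw [continuousOn_iff_continuous_domRestrict]
    have : Continuous fun q : ({t : ℝ | t ≠ 0 ∧ |t| < 1} ×ˢ (univ : Set ℝ) : Set (ℝ × ℝ)) =>
        ((⟨|q.1.1|, abs_pos.2 q.2.1.1, q.2.1.2⟩ : Ioo (0 : ℝ) 1), q.1.2) := by fun_prop
    exact (hc.comp this).congr fun q => (D.h_of_ne q.2.1.1 _).symm
  exact hcU.continuousAt ((hU.prod isOpen_univ).mem_nhds ⟨⟨h0, h1⟩, mem_univ _⟩)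

/-- `(t, s) ↦ h^α_t(s)` is continuous. -/
lemma continuousOn_h (hα : ∀ n, α n ∈ Icc (0 : ℝ) 1) :
    ContinuousOn (fun q : ℝ × ℝ => D.h α q.1 q.2) (Ioo (-1) 1 ×ˢ Icc (-1) 1) := by
  rintro ⟨t, s⟩ ⟨ht, hs⟩
  by_cases h0 : t = 0
  · subst h0
    rw [ContinuousWithinAt]
    have h1 : Tendsto (fun q : ℝ × ℝ => D.h α 0 q.2)
        (𝓝[Ioo (-1) 1 ×ˢ Icc (-1) 1] (0, s)) (𝓝 (D.h α 0 s)) :=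
      ((D.continuous_h_zero.comp continuous_snd).tendsto (0, s)).mono_left nhdsWithin_le_nhds
    have h2 : Tendsto (fun q : ℝ × ℝ => D.h α q.1 q.2 - D.h α 0 q.2)
        (𝓝[Ioo (-1) 1 ×ˢ Icc (-1) 1] (0, s)) (𝓝 0) := by
      refine squeeze_zero_norm' (a := fun q : ℝ × ℝ => |q.1|) ?_ ?_
      · filter_upwards [self_mem_nhdsWithin] with q hq
        exact D.abs_h_sub_h_zero_le hα (abs_lt.2 hq.1) hq.2
      · have : Tendsto (fun q : ℝ × ℝ => |q.1|) (𝓝 (0, s)) (𝓝 |(0 : ℝ)|) :=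
          (continuous_abs.comp continuous_fst).tendsto ((0 : ℝ), s)
        rw [abs_zero] at this
        exact this.mono_left nhdsWithin_le_nhds
    simpa using h2.add h1
  · exact (D.continuousAt_h hα h0 (abs_lt.2 ht) s).continuousWithinAt

lemma h_one (hα : ∀ n, α n ∈ Icc (0 : ℝ) 1) {t : ℝ} (h1 : |t| < 1) : D.h α t 1 = 1 := by
  rw [D.h_upper hα h1 (by linarith) le_rfl]; norm_num

lemma h_neg_one {t : ℝ} (h1 : |t| < 1) :
    D.h α t (-1) = -1 := by
  rw [D.h_lower h1 (by linarith)]; norm_num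

lemma h_bijOn (hα : ∀ n, α n ∈ Icc (0 : ℝ) 1) {t : ℝ} (h0 : t ≠ 0) (h1 : |t| < 1) :
    BijOn (D.h α t) (Icc (-1) 1) (Icc (-1) 1) := by
  have hm := D.h_strictMonoOn hα h0 h1
  refine ⟨fun s hs => ?_, hm.injOn, ?_⟩
  · have a := hm.monotoneOn (left_mem_Icc.2 (by norm_num)) hs hs.1
    have b := hm.monotoneOn hs (right_mem_Icc.2 (by norm_num)) hs.2
    rw [D.h_one hα h1] at b
    rw [D.h_neg_one h1] at a
    exact ⟨a, b⟩
  · have hc : ContinuousOn (D.h α t) (Icc (-1) 1) :=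
      (D.continuousOn_h hα).comp (f := fun s => (t, s)) (by fun_prop)
        fun s hs => ⟨abs_lt.1 h1, hs⟩
    have := intermediate_value_Icc (by norm_num : (-1 : ℝ) ≤ 1) hc
    rwa [D.h_one hα h1, D.h_neg_one h1] at this

section Inverse
variable (hα : ∀ n, α n ∈ Icc (0 : ℝ) 1) {d : ℝ} (hd0 : 0 < d) (hd1 : d < 1)
include hα hd0 hd1

lemma h_hInv {s : ℝ} (hs : s ∈ Icc (-1 : ℝ) 1) : D.h α d (D.hInv α d s) = s :=
  Function.invFunOn_eq
    ((D.h_bijOn hα hd0.ne' (by rwa [abs_of_pos hd0])).surjOn hs)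

lemma hInv_mem {s : ℝ} (hs : s ∈ Icc (-1 : ℝ) 1) : D.hInv α d s ∈ Icc (-1 : ℝ) 1 :=
  Function.invFunOn_mem
    ((D.h_bijOn hα hd0.ne' (by rwa [abs_of_pos hd0])).surjOn hs)

lemma hInv_h {s : ℝ} (hs : s ∈ Icc (-1 : ℝ) 1) : D.hInv α d (D.h α d s) = s :=
  (D.h_bijOn hα hd0.ne' (by rwa [abs_of_pos hd0])).injOn.leftInvOn_invFunOn hs

lemma hInv_upper {s : ℝ} (hs : d ≤ s) (hs1 : s ≤ 1) : D.hInv α d s = (1 + s) / 2 := by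
  have h1 : |d| < 1 := by rwa [abs_of_pos hd0]
  have : D.h α d ((1 + s) / 2) = s := by
    rw [D.h_upper hα h1 (by rw [abs_of_pos hd0]; linarith) (by linarith)]; ring
  rw [← this, D.hInv_h hα hd0 hd1 ⟨by linarith, by linarith⟩, this]

lemma hInv_lower {s : ℝ} (hs : s ≤ -d) (hs1 : -1 ≤ s) : D.hInv α d s = (-1 + s) / 2 := by
  have h1 : |d| < 1 := by rwa [abs_of_pos hd0]
  have : D.h α d ((-1 + s) / 2) = s := by
    rw [D.h_lower h1 (by rw [abs_of_pos hd0]; linarith)]; ring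
  rw [← this, D.hInv_h hα hd0 hd1 ⟨by linarith, by linarith⟩, this]

lemma hInv_strictMonoOn : StrictMonoOn (D.hInv α d) (Icc (-1) 1) := by
  intro x hx y hy hxy
  have h1 : |d| < 1 := by rwa [abs_of_pos hd0]
  rw [← (D.h_strictMonoOn hα hd0.ne' h1).lt_iff_lt (D.hInv_mem hα hd0 hd1 hx)
    (D.hInv_mem hα hd0 hd1 hy), D.h_hInv hα hd0 hd1 hx, D.h_hInv hα hd0 hd1 hy]
  exact hxy

/-- A strictly monotone map onto an interval is an order isomorphism, hence continuous. -/
lemma continuousOn_hInv : ContinuousOn (D.hInv α d) (Icc (-1) 1) := by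
  have hm := D.hInv_strictMonoOn hα hd0 hd1
  have him : D.hInv α d '' Icc (-1) 1 = Icc (-1) 1 := by
    apply Subset.antisymm
    · rintro _ ⟨s, hs, rfl⟩
      exact D.hInv_mem hα hd0 hd1 hs
    · intro s hs
      exact ⟨D.h α d s, (D.h_bijOn hα hd0.ne' (by rwa [abs_of_pos hd0])).mapsTo hs,
        D.hInv_h hα hd0 hd1 hs⟩
  have : OrdConnected (D.hInv α d '' Icc (-1) 1) := by rw [him]; exact ordConnected_Icc
  rw [continuousOn_iff_continuous_domRestrict]
  exact continuous_subtype_val.comp (hm.orderIso _ _).continuous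

end Inverse
end Choices

/-! ### Coordinates on the circle. -/

lemma rep_mem (u : UnitAddCircle) : rep u ∈ Ico (-1 / 2 : ℝ) (1 / 2) := by
  have := (AddCircle.equivIco (1 : ℝ) (-1 / 2) u).2
  norm_num at this ⊢
  exact this

lemma rep_mem_Icc (u : UnitAddCircle) : rep u ∈ Icc (-1 : ℝ) 1 := by
  have := rep_mem u
  simp only [mem_Ico, mem_Icc] at *
  constructor <;> linarith

@[simp] lemma coe_rep (u : UnitAddCircle) : ((rep u : ℝ) : UnitAddCircle) = u :=
  (AddCircle.equivIco (1 : ℝ) (-1 / 2)).symm_apply_apply u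

lemma rep_coe {s : ℝ} (hs : s ∈ Ico (-1 / 2 : ℝ) (1 / 2)) : rep (s : UnitAddCircle) = s := by
  have h : s ∈ Ico (-1 / 2 : ℝ) (-1 / 2 + 1) := by norm_num at hs ⊢; exact hs
  have := (AddCircle.equivIco (1 : ℝ) (-1 / 2)).apply_symm_apply ⟨s, h⟩
  exact congrArg Subtype.val this

lemma abs_rep (u : UnitAddCircle) : |rep u| = ‖u‖ := by
  have h := rep_mem u
  conv_rhs => rw [← coe_rep u]
  refine ((AddCircle.norm_coe_eq_abs_iff 1 one_ne_zero).2 ?_).symm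
  rw [abs_one, abs_le]
  constructor <;> linarith [h.1, h.2]

lemma continuousAt_rep {u : UnitAddCircle} (hu : u ≠ ((-1 / 2 : ℝ) : UnitAddCircle)) :
    ContinuousAt rep u :=
  continuous_subtype_val.continuousAt.comp (AddCircle.continuousAt_equivIco 1 (-1 / 2) hu)

/-- A family of maps of `[-1/2, 1/2]` that fixes a neighbourhood of the end points gives a
continuous family of maps of the circle. -/
lemma continuousOn_coe_rep {P : Type*} [TopologicalSpace P] {β : P × ℝ → ℝ} {S : Set P} {c : ℝ}
    (hβ : ContinuousOn β (S ×ˢ Icc (-1) 1)) (hc : c < 1 / 2)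
    (hfix : ∀ p ∈ S, ∀ r, c ≤ |r| → |r| ≤ 1 → β (p, r) = r) :
    ContinuousOn (fun q : P × UnitAddCircle => (β (q.1, rep q.2) : UnitAddCircle))
      (S ×ˢ univ) := by
  rintro ⟨p, v⟩ ⟨hp, -⟩
  -- `rep` jumps at this point, but near it `β` is the identity, so the induced circle map is
  -- locally the second projection.
  by_cases hv : v = ((-1 / 2 : ℝ) : UnitAddCircle)
  · have hv' : c < ‖v‖ := by
      rw [hv, (AddCircle.norm_coe_eq_abs_iff 1 one_ne_zero).2 (by rw [abs_le]; norm_num)]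
      rw [abs_of_neg (by norm_num)]; linarith
    have key : ∀ q ∈ S ×ˢ (univ : Set UnitAddCircle), c < ‖q.2‖ →
        (β (q.1, rep q.2) : UnitAddCircle) = q.2 := by
      intro q hq h
      rw [hfix q.1 hq.1 _ (by rw [abs_rep]; exact h.le) (abs_le.2 (rep_mem_Icc _)), coe_rep]
    refine continuous_snd.continuousWithinAt.congr_of_eventuallyEq (f := Prod.snd) ?_
      (key _ ⟨hp, mem_univ _⟩ hv')
    have : ∀ᶠ q : P × UnitAddCircle in 𝓝 (p, v), c < ‖q.2‖ :=
      (continuous_norm.comp continuous_snd).continuousAt.eventually (lt_mem_nhds hv')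
    filter_upwards [self_mem_nhdsWithin, mem_nhdsWithin_of_mem_nhds this] with q hq h
    exact key q hq h
  · refine (AddCircle.continuous_mk' 1).continuousAt.comp_continuousWithinAt ?_
    have h1 : ContinuousWithinAt (fun q : P × UnitAddCircle => (q.1, rep q.2)) (S ×ˢ univ) (p, v) :=
      continuous_fst.continuousWithinAt.prodMk
        ((continuousAt_rep hv).comp (f := Prod.snd) continuousAt_snd).continuousWithinAt
    exact ContinuousWithinAt.comp (t := S ×ˢ Icc (-1) 1) (hβ (p, rep v) ⟨hp, rep_mem_Icc v⟩) h1
      fun q hq => ⟨hq.1, rep_mem_Icc q.2⟩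

/-! ### The local maps `Lam`. -/

namespace Choices
variable (D : Choices) {α : ℕ → ℝ}

/-- The fibre map `h^α_t ∘ (h^α_d)⁻¹`. -/
def kap (α : ℕ → ℝ) (d t s : ℝ) : ℝ := D.h α t (D.hInv α d s)

section Kap
variable (hα : ∀ n, α n ∈ Icc (0 : ℝ) 1) {d : ℝ} (hd0 : 0 < d) (hd1 : d < 1)
include hα hd0 hd1

lemma kap_fix {c t s : ℝ} (hc : d ≤ c) (hc1 : c < 1) (ht : |t| ≤ c) (hs : c ≤ |s|)
    (hs1 : |s| ≤ 1) : D.kap α d t s = s := by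
  have h1 : |t| < 1 := by linarith
  rcases le_total 0 s with h | h
  · rw [abs_of_nonneg h] at hs hs1
    rw [kap, D.hInv_upper hα hd0 hd1 (by linarith) hs1, D.h_upper hα h1 (by linarith) (by linarith)]
    ring
  · rw [abs_of_nonpos h] at hs hs1
    rw [kap, D.hInv_lower hα hd0 hd1 (by linarith) (by linarith), D.h_lower h1 (by linarith)]
    ring

lemma kap_monotoneOn {t : ℝ} (ht : |t| < 1) : MonotoneOn (D.kap α d t) (Icc (-1) 1) :=
  fun _ hx _ hy hxy => D.h_monotoneOn hα ht (D.hInv_mem hα hd0 hd1 hx)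
    (D.hInv_mem hα hd0 hd1 hy) ((D.hInv_strictMonoOn hα hd0 hd1).monotoneOn hx hy hxy)

lemma abs_kap_le {c t s : ℝ} (hc : d ≤ c) (hc1 : c < 1) (ht : |t| ≤ c) (hs : |s| ≤ c) :
    |D.kap α d t s| ≤ c := by
  have hm := D.kap_monotoneOn hα hd0 hd1 (ht.trans_lt hc1)
  have hc0 : 0 < c := by linarith
  have e1 := D.kap_fix hα hd0 hd1 (s := c) hc hc1 ht (le_abs_self c) (by
    rw [abs_of_pos hc0]; linarith)
  have e2 := D.kap_fix hα hd0 hd1 (s := -c) hc hc1 ht (by rw [abs_neg]; exact le_abs_self c) (by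
    rw [abs_neg, abs_of_pos hc0]; linarith)
  rw [abs_le] at hs ⊢
  have i1 := hm (a := -c) (b := s) ⟨by linarith, by linarith⟩ ⟨by linarith, by linarith⟩ hs.1
  have i2 := hm (a := s) (b := c) ⟨by linarith, by linarith⟩ ⟨by linarith, by linarith⟩ hs.2
  rw [e2] at i1
  rw [e1] at i2
  exact ⟨i1, i2⟩

lemma kap_mem_Ico {c t s : ℝ} (hc : d ≤ c) (hc1 : c < 1 / 2) (ht : |t| ≤ c)
    (hs : s ∈ Ico (-1 / 2 : ℝ) (1 / 2)) : D.kap α d t s ∈ Ico (-1 / 2 : ℝ) (1 / 2) := by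
  rcases le_total c |s| with h | h
  · rwa [D.kap_fix hα hd0 hd1 hc (by linarith) ht h
      (abs_le.2 ⟨by linarith [hs.1], by linarith [hs.2]⟩)]
  · have := abs_le.1 (D.abs_kap_le hα hd0 hd1 hc (by linarith) ht h)
    exact ⟨by linarith, by linarith⟩

lemma kap_injOn {t : ℝ} (h0 : t ≠ 0) (ht : |t| < 1) : InjOn (D.kap α d t) (Icc (-1) 1) :=
  fun _ hx _ hy h => (D.hInv_strictMonoOn hα hd0 hd1).injOn hx hy
    ((D.h_bijOn hα h0 ht).injOn (D.hInv_mem hα hd0 hd1 hx) (D.hInv_mem hα hd0 hd1 hy) h)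

/-- The only plateau of `h 0` on `[-1, 1]` is `[-1/2, 1/2]`, and its value there is 0. -/
lemma kap_zero_eq {s s' : ℝ} (hs : s ∈ Icc (-1 : ℝ) 1) (hs' : s' ∈ Icc (-1 : ℝ) 1)
    (h : D.kap α d 0 s = D.kap α d 0 s') : s = s' ∨ D.kap α d 0 s = 0 := by
  have a := D.hInv_mem hα hd0 hd1 hs
  have b := D.hInv_mem hα hd0 hd1 hs'
  have : D.hInv α d s = D.hInv α d s' ∨ D.kap α d 0 s = 0 := by
    simp only [kap, h_zero] at h ⊢
    simp only [mem_Icc] at a b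
    split_ifs at h ⊢ <;> first | exact Or.inr rfl | (left; linarith) | (right; linarith)
  exact this.imp_left fun h => (D.hInv_strictMonoOn hα hd0 hd1).injOn hs hs' h

/-- Since `h d` takes the ends `±1/2` of the plateau to `±d/2`, these two points are both collapsed
to 0. -/
lemma kap_zero_half : D.kap α d 0 (d / 2) = 0 := by
  have h1 : |d| < 1 := by rwa [abs_of_pos hd0]
  have := D.h_vertex hα hd0.ne' h1 (x := 1 / 2) (y := |d| / 2) (by simp [hVertices])
  rw [abs_of_pos hd0] at this
  rw [kap, ← this, D.hInv_h hα hd0 hd1 (by constructor <;> norm_num), h_zero]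
  norm_num

lemma kap_zero_neg_half : D.kap α d 0 (-d / 2) = 0 := by
  have h1 : |d| < 1 := by rwa [abs_of_pos hd0]
  have := D.h_vertex hα hd0.ne' h1 (x := -1 / 2) (y := -|d| / 2) (by simp [hVertices])
  rw [abs_of_pos hd0] at this
  rw [kap, ← this, D.hInv_h hα hd0 hd1 (by constructor <;> norm_num), h_zero]
  norm_num

lemma kap_self {s : ℝ} (hs : s ∈ Icc (-1 : ℝ) 1) : D.kap α d d s = s :=
  D.h_hInv hα hd0 hd1 hs

lemma continuousOn_kap :
    ContinuousOn (fun q : ℝ × ℝ => D.kap α d q.1 q.2) (Ioo (-1) 1 ×ˢ Icc (-1) 1) := by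
  refine (D.continuousOn_h hα).comp (f := fun q : ℝ × ℝ => (q.1, D.hInv α d q.2)) ?_
    fun q hq => ⟨hq.1, D.hInv_mem hα hd0 hd1 hq.2⟩
  exact continuousOn_fst.prodMk
    ((D.continuousOn_hInv hα hd0 hd1).comp continuousOn_snd fun q hq => hq.2)

lemma kap_surjOn {t : ℝ} (ht : |t| ≤ d) : SurjOn (D.kap α d t) (Icc (-d) d) (Icc (-d) d) := by
  have hc : ContinuousOn (D.kap α d t) (Icc (-d) d) :=
    (D.continuousOn_kap hα hd0 hd1).comp (f := fun s => (t, s)) (by fun_prop)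
      fun s hs => ⟨abs_lt.1 (ht.trans_lt hd1), by linarith [hs.1], by linarith [hs.2]⟩
  have := intermediate_value_Icc (by linarith) hc
  rwa [D.kap_fix hα hd0 hd1 le_rfl hd1 ht (by rw [abs_neg]; exact le_abs_self d)
    (by rw [abs_neg, abs_of_pos hd0]; exact hd1.le), D.kap_fix hα hd0 hd1 le_rfl hd1 ht
    (le_abs_self d) (by rw [abs_of_pos hd0]; exact hd1.le)] at this

end Kap

lemma kap_abs (d t s : ℝ) : D.kap α d |t| s = D.kap α d t s := D.h_abs _ _

/-- `h_t ∘ h_d⁻¹ = (h_t ∘ h_e⁻¹) ∘ (h_e ∘ h_d⁻¹)`. -/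
lemma kap_comp (hα : ∀ n, α n ∈ Icc (0 : ℝ) 1) {d e : ℝ} (hd0 : 0 < d) (hd1 : d < 1)
    (he0 : 0 < e) (he1 : e < 1) (t : ℝ) {s : ℝ} (hs : s ∈ Icc (-1 : ℝ) 1) :
    D.kap α e t (D.kap α d e s) = D.kap α d t s := by
  simp only [kap]
  rw [D.hInv_h hα he0 he1 (D.hInv_mem hα hd0 hd1 hs)]

/-- `dist` on the product is the maximum metric, so the squares are its closed balls; `torusDist` is
kept for the Euclidean conditions. -/
lemma A_eq (δ : ℕ → ℝ) (n : ℕ) : D.A δ n = Metric.closedBall (D.z n) (δ n) := by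
  ext u
  simp [A, abs_rep, dist_eq_norm, Prod.norm_def]

lemma mem_A {δ : ℕ → ℝ} {n : ℕ} {u : Torus} :
    u ∈ D.A δ n ↔ ‖u.1 - (D.z n).1‖ ≤ δ n ∧ ‖u.2 - (D.z n).2‖ ≤ δ n := by
  simp [A, abs_rep]

lemma Lam_of_notMem {δ : ℕ → ℝ} {n : ℕ} {u : Torus} (hu : u ∉ D.A δ n) :
    D.Lam α δ n u = u := by
  simp [Lam, hu]

@[simp] lemma Lam_fst (δ : ℕ → ℝ) (n : ℕ) (u : Torus) : (D.Lam α δ n u).1 = u.1 := by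
  unfold Lam; split_ifs <;> rfl

section Lam
variable (hα : ∀ n, α n ∈ Icc (0 : ℝ) 1) {δ : ℕ → ℝ} {n : ℕ} (h0 : 0 < δ n) (h1 : δ n < 1 / 2)
include hα h0 h1

/-- The formula is valid on the whole vertical strip, not only on the square, because the fibre map
fixes heights of modulus at least `δ n`. -/
lemma Lam_eq {u : Torus} (hu : ‖u.1 - (D.z n).1‖ ≤ δ n) :
    D.Lam α δ n u =
      (u.1, (D.z n).2 + (D.kap α (δ n) ‖u.1 - (D.z n).1‖ (rep (u.2 - (D.z n).2)) : ℝ)) := by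
  rw [← abs_rep, kap_abs]
  by_cases h : u ∈ D.A δ n
  · simp [Lam, h, kap]
  · have h2 : δ n ≤ |rep (u.2 - (D.z n).2)| := by
      rw [abs_rep]
      by_contra! h3
      exact h (D.mem_A.2 ⟨hu, h3.le⟩)
    rw [D.Lam_of_notMem h, D.kap_fix hα h0 (by linarith) le_rfl (by linarith)
      (by rwa [abs_rep]) h2 (abs_le.2 (rep_mem_Icc _))]
    simp

/-- Truncation at `δ n` gives one formula on the whole torus, because the fibre map at `t = δ n` is
the identity. Continuity can be read off from it. -/
lemma Lam_eq_min (u : Torus) :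
    D.Lam α δ n u = (u.1, (D.z n).2 +
      (D.kap α (δ n) (min ‖u.1 - (D.z n).1‖ (δ n)) (rep (u.2 - (D.z n).2)) : ℝ)) := by
  rcases le_total ‖u.1 - (D.z n).1‖ (δ n) with h | h
  · rw [min_eq_left h, D.Lam_eq hα h0 h1 h]
  · rw [min_eq_right h, D.kap_self hα h0 (by linarith) (rep_mem_Icc _)]
    rcases h.eq_or_lt with h | h
    · rw [D.Lam_eq hα h0 h1 h.symm.le, ← h, D.kap_self hα h0 (by linarith) (rep_mem_Icc _)]
    · rw [D.Lam_of_notMem fun h' => absurd (D.mem_A.1 h').1 (not_le.2 h)]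
      simp

lemma continuous_Lam : Continuous (D.Lam α δ n) := by
  have hk := continuousOn_coe_rep (S := Icc 0 (δ n)) (c := δ n)
    ((D.continuousOn_kap hα h0 (by linarith)).mono
      (prod_mono (fun t ht => ⟨by linarith [ht.1], by linarith [ht.2]⟩) le_rfl)) h1
    (fun t ht r hr hr1 => D.kap_fix hα h0 (by linarith) le_rfl (by linarith)
      (by rw [abs_of_nonneg ht.1]; exact ht.2) hr hr1)
  have hg : Continuous fun u : Torus => (min ‖u.1 - (D.z n).1‖ (δ n), u.2 - (D.z n).2) := by
    fun_prop
  have := hk.comp_continuous hg fun u => ⟨⟨le_min (norm_nonneg _) h0.le, min_le_right _ _⟩,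
    mem_univ _⟩
  have h2 : Continuous fun u : Torus => (u.1, (D.z n).2 +
      (D.kap α (δ n) (min ‖u.1 - (D.z n).1‖ (δ n)) (rep (u.2 - (D.z n).2)) : UnitAddCircle)) :=
    continuous_fst.prodMk (continuous_const.add this)
  exact h2.congr fun u => (D.Lam_eq_min hα h0 h1 u).symm

lemma Lam_mem_A {u : Torus} (hu : u ∈ D.A δ n) : D.Lam α δ n u ∈ D.A δ n := by
  rw [D.mem_A] at hu ⊢
  rw [D.Lam_eq hα h0 h1 hu.1]
  refine ⟨hu.1, ?_⟩
  have := D.abs_kap_le hα h0 (by linarith) (t := ‖u.1 - (D.z n).1‖)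
    (s := rep (u.2 - (D.z n).2)) le_rfl (by linarith) (by simpa using hu.1)
    (by simpa [abs_rep] using hu.2)
  simp only [add_sub_cancel_left]
  rwa [(AddCircle.norm_coe_eq_abs_iff 1 one_ne_zero).2 (by rw [abs_one]; linarith)]

lemma dist_Lam_le (u : Torus) : dist (D.Lam α δ n u) u ≤ 2 * δ n := by
  by_cases h : u ∈ D.A δ n
  · have h2 := D.Lam_mem_A hα h0 h1 h
    rw [A_eq, Metric.mem_closedBall] at h h2
    linarith [dist_triangle_right (D.Lam α δ n u) u (D.z n)]
  · rw [D.Lam_of_notMem h, dist_self]; linarith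

lemma Lam_surjective : Function.Surjective (D.Lam α δ n) := by
  intro w
  by_cases h : w ∈ D.A δ n
  · rw [mem_A] at h
    obtain ⟨s, hs, hs'⟩ := D.kap_surjOn hα h0 (by linarith) (t := ‖w.1 - (D.z n).1‖)
      (by simpa using h.1) (a := rep (w.2 - (D.z n).2))
      (abs_le.1 (by simpa [abs_rep] using h.2))
    refine ⟨(w.1, (D.z n).2 + (s : ℝ)), ?_⟩
    rw [D.Lam_eq hα h0 h1 (by exact h.1)]
    simp only [add_sub_cancel_left]
    rw [rep_coe ⟨by linarith [hs.1], by linarith [hs.2]⟩, hs']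
    simp
  · exact ⟨w, D.Lam_of_notMem h⟩

lemma Lam_eq_Lam {u v : Torus} (h : D.Lam α δ n u = D.Lam α δ n v) :
    u = v ∨ (u.1 = (D.z n).1 ∧ D.Lam α δ n u = D.z n) := by
  have e1 : u.1 = v.1 := by simpa using congrArg Prod.fst h
  rcases le_or_gt ‖u.1 - (D.z n).1‖ (δ n) with ht | ht
  · have hu := D.Lam_eq hα h0 h1 ht
    have hv := D.Lam_eq hα h0 h1 (u := v) (by rwa [← e1])
    rw [← e1] at hv
    have ht' : |‖u.1 - (D.z n).1‖| ≤ δ n := by simpa using ht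
    have hk : D.kap α (δ n) ‖u.1 - (D.z n).1‖ (rep (u.2 - (D.z n).2)) =
        D.kap α (δ n) ‖u.1 - (D.z n).1‖ (rep (v.2 - (D.z n).2)) := by
      rw [hu, hv] at h
      have := add_left_cancel (congrArg Prod.snd h)
      rw [← rep_coe (D.kap_mem_Ico hα h0 (by linarith) le_rfl h1 ht' (rep_mem _)), this,
        rep_coe (D.kap_mem_Ico hα h0 (by linarith) le_rfl h1 ht' (rep_mem _))]
    have fin : rep (u.2 - (D.z n).2) = rep (v.2 - (D.z n).2) → u = v := by
      intro h
      have := congrArg (fun s : ℝ => (s : UnitAddCircle)) h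
      simp only [coe_rep, sub_left_inj] at this
      exact Prod.ext e1 this
    by_cases ht0 : ‖u.1 - (D.z n).1‖ = 0
    · rw [ht0] at hk hu
      rcases D.kap_zero_eq hα h0 (by linarith) (rep_mem_Icc _) (rep_mem_Icc _) hk with h | h
      · exact Or.inl (fin h)
      · have hx := sub_eq_zero.1 (norm_eq_zero.1 ht0)
        refine Or.inr ⟨hx, ?_⟩
        rw [hu, h, hx]
        simp
    · exact Or.inl (fin (D.kap_injOn hα h0 (by linarith) ht0 (by linarith) (rep_mem_Icc _)
        (rep_mem_Icc _) hk))
  · have hn : ∀ w : Torus, w.1 = u.1 → w ∉ D.A δ n := fun w hw h' => by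
      have := (D.mem_A.1 h').1
      rw [hw] at this; linarith
    rw [D.Lam_of_notMem (hn u rfl), D.Lam_of_notMem (hn v e1.symm)] at h
    exact Or.inl h

lemma exists_Lam_eq_z : ∃ u v : Torus, u ≠ v ∧ D.Lam α δ n u = D.z n ∧ D.Lam α δ n v = D.z n := by
  have key : ∀ s ∈ Ico (-1 / 2 : ℝ) (1 / 2), D.kap α (δ n) 0 s = 0 →
      D.Lam α δ n ((D.z n).1, (D.z n).2 + (s : UnitAddCircle)) = D.z n := by
    intro s hs h
    rw [D.Lam_eq hα h0 h1 (by simpa using h0.le)]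
    simp [rep_coe hs, h]
  have m1 : δ n / 2 ∈ Ico (-1 / 2 : ℝ) (1 / 2) := ⟨by linarith, by linarith⟩
  have m2 : -δ n / 2 ∈ Ico (-1 / 2 : ℝ) (1 / 2) := ⟨by linarith, by linarith⟩
  refine ⟨_, _, ?_, key _ m1 (D.kap_zero_half hα h0 (by linarith)),
    key _ m2 (D.kap_zero_neg_half hα h0 (by linarith))⟩
  intro h
  have := add_left_cancel (congrArg Prod.snd h)
  have := congrArg rep this
  rw [rep_coe m1, rep_coe m2] at this
  linarith

/-- Near the fibre of `z_n` the maps `Λ_n` and `Λ_m` differ, after a translation, by a continuous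
fibre-preserving map. -/
lemma exists_Lam_conj {m : ℕ} (m0 : 0 < δ m) (m1 : δ m < 1 / 2) {c : Torus}
    (hc : D.z m = D.z n + c) :
    ∃ B : Torus → Torus, Continuous B ∧ (∀ v, (B v).1 = v.1) ∧
      ∀ u : Torus, ‖u.1 - (D.z n).1‖ ≤ min (δ n) (δ m) →
        D.Lam α δ n u + c = D.Lam α δ m (B (u + c)) := by
  set e := max (δ n) (δ m) with he
  have e1 : e < 1 / 2 := max_lt h1 m1
  have em : |δ m| ≤ e := by rw [abs_of_pos m0]; exact le_max_right _ _
  have hk := continuousOn_coe_rep (P := Unit) (S := univ) (c := e)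
    (β := fun q => D.kap α (δ n) (δ m) q.2)
    ((D.continuousOn_kap hα h0 (by linarith)).comp (f := fun q : Unit × ℝ => (δ m, q.2))
      (by fun_prop) (fun q hq => ⟨⟨by linarith, by linarith⟩, hq.2⟩)) e1
    (fun _ _ r hr hr1 => D.kap_fix hα h0 (by linarith) (le_max_left _ _) (by linarith) em hr hr1)
  -- `B` applies `h (δ m)` after the inverse of `h (δ n)` on every fibre. It does not involve `t`:
  -- the factor `h t`, which is singular at `t = 0`, is common to both sides.
  refine ⟨fun v => (v.1, (D.z m).2 + (D.kap α (δ n) (δ m) (rep (v.2 - (D.z m).2)) : ℝ)),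
    ?_, fun _ => rfl, ?_⟩
  · refine continuous_fst.prodMk (continuous_const.add ?_)
    exact hk.comp_continuous (f := fun v : Torus => ((), v.2 - (D.z m).2)) (by fun_prop)
      fun _ => ⟨mem_univ _, mem_univ _⟩
  · intro u hu
    have hc1 : (D.z m).1 = (D.z n).1 + c.1 := by rw [hc]; rfl
    have hc2 : (D.z m).2 = (D.z n).2 + c.2 := by rw [hc]; rfl
    have a1 : u.1 + c.1 - (D.z m).1 = u.1 - (D.z n).1 := by rw [hc1]; abel
    have a2 : u.2 + c.2 - (D.z m).2 = u.2 - (D.z n).2 := by rw [hc2]; abel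
    rw [D.Lam_eq hα h0 h1 (hu.trans (min_le_left _ _)), D.Lam_eq hα m0 m1
      (by simpa [a1] using hu.trans (min_le_right _ _))]
    simp only [Prod.fst_add, Prod.snd_add, a1, a2, add_sub_cancel_left]
    rw [rep_coe (D.kap_mem_Ico hα h0 (by linarith) (le_max_left _ _) e1 em (rep_mem _)),
      D.kap_comp hα h0 (by linarith) m0 (by linarith) _ (rep_mem_Icc _)]
    refine Prod.ext rfl ?_
    simp only [Prod.snd_add, hc2]
    abel

end Lam
end Choices

/-! ### Unique preimages in compact spaces, and the orbit `z`. -/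

/-- If `f` is a continuous self-map of a compact space and `f⁻¹(w) = {y}`, then points with image
close to `w` are close to `y`. -/
lemma comap_nhds_le_of_unique {K Y : Type*} [TopologicalSpace K] [CompactSpace K]
    [TopologicalSpace Y] [T2Space Y] {f : K → Y} (hf : Continuous f) {y : K}
    (hu : ∀ u, f u = f y → u = y) : comap f (𝓝 (f y)) ≤ 𝓝 y := by
  have h := hf.isClosedMap.comap_nhds_le (y := f y)
  have : f ⁻¹' {f y} = {y} := by
    ext u; exact ⟨hu u, fun h => congrArg f h⟩
  rwa [this, nhdsSet_singleton] at h

lemma exists_dist_lt_of_unique {K Y : Type*} [PseudoMetricSpace K] [CompactSpace K] [MetricSpace Y]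
    {f : K → Y} (hf : Continuous f) {y : K} (hu : ∀ u, f u = f y → u = y) {e : ℝ} (he : 0 < e) :
    ∃ r > 0, ∀ u, dist (f u) (f y) < r → dist u y < e := by
  have := comap_nhds_le_of_unique hf hu (Metric.ball_mem_nhds y he)
  obtain ⟨t, ht, hts⟩ := mem_comap.1 this
  obtain ⟨r, hr, hrt⟩ := Metric.mem_nhds_iff.1 ht
  exact ⟨r, hr, fun u hu => hts (hrt hu)⟩

namespace Choices
variable (D : Choices) {α : ℕ → ℝ}

lemma T_apply (u : Torus) : D.T u = u + (D.a, D.b) := rfl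

lemma T_zpow_apply (k : ℤ) (u : Torus) : (D.T ^ k) u = u + k • ((D.a, D.b) : Torus) := by
  have hn : ∀ (n : ℕ) (v : Torus), (D.T ^ n) v = v + n • ((D.a, D.b) : Torus) := by
    intro n v
    induction n with
    | zero => simp
    | succ n ih => rw [pow_succ', Homeomorph.mul_apply, ih, T_apply, succ_nsmul, add_assoc]
  cases k with
  | ofNat n => simpa using hn n u
  | negSucc n =>
    have h : (D.T ^ (n + 1)) ((D.T ^ (-((n + 1 : ℕ) : ℤ))) u) = u := by
      rw [← Homeomorph.mul_apply, ← zpow_natCast, ← zpow_add]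
      simp
    rw [hn] at h
    rw [Int.negSucc_eq, neg_zsmul, eq_add_neg_iff_add_eq]
    exact_mod_cast h

/-- The exponent of `z_n` in the orbit of `z_0`. -/
def expo (n : ℕ) : ℤ := if n % 2 = 0 then (n / 2 : ℕ) else -((n / 2 : ℕ) : ℤ) - 1

lemma z_eq (n : ℕ) : D.z n = D.z₀ + expo n • ((D.a, D.b) : Torus) := by
  unfold z expo
  split_ifs <;> exact D.T_zpow_apply _ _

lemma expo_injective : Function.Injective expo := by
  intro m n h
  unfold expo at h
  split_ifs at h <;> omega

lemma expo_even (k : ℕ) : expo (2 * k) = k := by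
  rw [expo, if_pos (by omega), show 2 * k / 2 = k by omega]

lemma expo_odd (k : ℕ) : expo (2 * k + 1) = -k - 1 := by
  rw [expo, if_neg (by omega), show (2 * k + 1) / 2 = k by omega]

lemma sigma_even (k : ℕ) : sigma (2 * k) = 2 * (k + 1) := by
  unfold sigma; split_ifs <;> omega

lemma sigma_odd (k : ℕ) : sigma (2 * (k + 1) + 1) = 2 * k + 1 := by
  unfold sigma; split_ifs <;> omega

lemma tau_even (k : ℕ) : tau (2 * (k + 1)) = 2 * k := by
  rw [tau, if_neg (by omega), if_pos (by omega)]; omega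

lemma tau_odd (k : ℕ) : tau (2 * k + 1) = 2 * (k + 1) + 1 := by
  rw [tau, if_neg (by omega), if_neg (by omega)]; omega

lemma expo_sigma (n : ℕ) : expo (sigma n) = expo n + 1 := by
  obtain ⟨k, rfl | rfl⟩ := n.even_or_odd'
  · rw [sigma_even, expo_even, expo_even]; push_cast; rfl
  · cases k with
    | zero => rfl
    | succ k => rw [sigma_odd, expo_odd, expo_odd]; push_cast; ring

lemma expo_tau (n : ℕ) : expo (tau n) = expo n - 1 := by
  obtain ⟨k, rfl | rfl⟩ := n.even_or_odd'
  · cases k with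
    | zero => rfl
    | succ k => rw [tau_even, expo_even, expo_even]; push_cast; ring
  · rw [tau_odd, expo_odd, expo_odd]; push_cast; ring

instance : Nontrivial UnitAddCircle :=
  ⟨0, ((1 / 4 : ℝ) : UnitAddCircle), fun h => by
    have := congrArg rep h
    rw [rep_coe (by norm_num), ← AddCircle.coe_zero, rep_coe (by norm_num)] at this
    norm_num at this⟩

/-- Otherwise the multiples of `a` would form a finite set. Being the projection of an orbit of a
minimal map, it is also dense in the circle, which is infinite. -/
lemma zsmul_a_ne_zero {k : ℤ} (hk : k ≠ 0) : k • D.a ≠ 0 := by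
  intro h
  have hfin : IsOfFinAddOrder D.a := isOfFinAddOrder_iff_zsmul_eq_zero.2 ⟨k, hk, h⟩
  have hS : (AddSubgroup.zmultiples D.a : Set UnitAddCircle).Finite :=
    finite_zmultiples.2 hfin
  have hd := D.minimal_rotation (0 : Torus)
  have hd1 : Dense (AddSubgroup.zmultiples D.a : Set UnitAddCircle) := by
    have := Prod.fst_surjective.denseRange.dense_image continuous_fst hd
    refine this.mono ?_
    rintro _ ⟨_, ⟨n, rfl⟩, rfl⟩
    have := D.T_zpow_apply n 0
    refine ⟨n, ?_⟩
    exact (by rw [show (D.T ^ n) 0 = _ from this]; simp :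
      n • D.a = ((D.T ^ n) (0 : Torus)).1)
  have huniv : (AddSubgroup.zmultiples D.a : Set UnitAddCircle) = univ := by
    rw [← hd1.closure_eq, hS.isClosed.closure_eq]
  rw [huniv] at hS
  exact isPreconnected_univ.infinite_of_nontrivial nontrivial_univ hS

lemma z_fst_injective : Function.Injective fun n => (D.z n).1 := by
  intro m n h
  simp only [z_eq, Prod.fst_add, Prod.smul_fst, add_right_inj] at h
  apply expo_injective
  by_contra hne
  refine D.zsmul_a_ne_zero (sub_ne_zero.2 hne) ?_
  rw [sub_zsmul, h]; exact add_neg_cancel _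

lemma z_fst_ne {m n : ℕ} (h : m ≠ n) : (D.z m).1 ≠ (D.z n).1 := fun h' => h (D.z_fst_injective h')

/-- Baire's theorem: a countable intersection of dense open sets. -/
lemma dense_X : Dense D.X := by
  have : D.X = ⋂ n, {p : Torus | p.1 ≠ (D.z n).1} := by ext p; simp [X]
  rw [this]
  have hx : ∀ n, IsOpen ({(D.z n).1}ᶜ : Set UnitAddCircle) := fun n => isOpen_compl_singleton
  refine dense_iInter_of_isOpen_nat (fun n => (hx n).preimage continuous_fst) fun n => ?_
  have := ConnectedSpace.neBot_nhdsWithin_compl_of_nontrivial_of_t1space (D.z n).1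
  exact (dense_compl_singleton (D.z n).1).preimage isOpenMap_fst

lemma mem_X_congr {u v : Torus} (h : u.1 = v.1) : u ∈ D.X ↔ v ∈ D.X := by
  simp [X, h]

/-- A translation that permutes the points `z_n` by `π`, where `π` changes the order only of
neighbouring indices. -/
structure IsShift (π : ℕ → ℕ) (R : Torus → Torus) (c : Torus) : Prop where
  apply : ∀ u, R u = u + c
  z : ∀ n, D.z (π n) = D.z n + c
  inj : Function.Injective π
  surj : Function.Surjective π
  order : ∀ m k, m < k → π k < π m → π m ≤ π k + 5

lemma sigma_tau (n : ℕ) : sigma (tau n) = n := expo_injective (by rw [expo_sigma, expo_tau]; ring)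

lemma tau_sigma (n : ℕ) : tau (sigma n) = n := expo_injective (by rw [expo_tau, expo_sigma]; ring)

lemma isShift_sigma : D.IsShift sigma D.T (D.a, D.b) where
  apply _ := rfl
  z n := by rw [z_eq, z_eq, expo_sigma, add_zsmul, one_zsmul, add_assoc]
  inj := Function.LeftInverse.injective tau_sigma
  surj := Function.RightInverse.surjective sigma_tau
  order m k h1 h2 := by unfold sigma at *; split_ifs at * <;> omega

lemma isShift_tau : D.IsShift tau D.T.symm (-(D.a, D.b)) where
  apply u := rfl
  z n := by rw [z_eq, z_eq, expo_tau, sub_zsmul, one_zsmul, ← add_assoc]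
  inj := Function.LeftInverse.injective sigma_tau
  surj := Function.RightInverse.surjective tau_sigma
  order m k h1 h2 := by unfold tau at *; split_ifs at * <;> omega

/-- The trivial shift makes statements about reordered products available for `Phi` itself. -/
lemma isShift_id : D.IsShift id id 0 where
  apply u := by simp
  z n := by simp
  inj := Function.injective_id
  surj := Function.surjective_id
  order m k h1 h2 := by simp at *; omega

namespace IsShift
variable {D} {π : ℕ → ℕ} {R : Torus → Torus} {c : Torus} (hR : D.IsShift π R c)
include hR

lemma z_fst (n : ℕ) : (D.z (π n)).1 = (D.z n).1 + c.1 := by rw [hR.z]; rfl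

lemma mem_X {u : Torus} : R u ∈ D.X ↔ u ∈ D.X := by
  rw [hR.apply]
  constructor
  · intro h n hn
    exact h (π n) (by rw [hR.z_fst, Prod.fst_add, hn])
  · intro h n hn
    obtain ⟨m, rfl⟩ := hR.surj n
    rw [hR.z_fst, Prod.fst_add, add_left_inj] at hn
    exact h m hn

lemma continuous : Continuous R := by
  have : R = fun u => u + c := funext hR.apply
  rw [this]; fun_prop

end IsShift
end Choices

/-! ### Compositions of fibre-preserving maps. -/

section Iter
variable {L : ℕ → Torus → Torus}

lemma iter_fst (hL : ∀ k u, (L k u).1 = u.1) (n : ℕ) (u : Torus) : (iter L n u).1 = u.1 := by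
  induction n with
  | zero => exact hL 0 u
  | succ n ih => exact (hL _ _).trans ih

lemma continuous_iter (hL : ∀ k, Continuous (L k)) (n : ℕ) : Continuous (iter L n) := by
  induction n with
  | zero => exact hL 0
  | succ n ih => exact (hL _).comp ih

lemma iter_surjective (hL : ∀ k, Function.Surjective (L k)) (n : ℕ) :
    Function.Surjective (iter L n) := by
  induction n with
  | zero => exact hL 0
  | succ n ih => exact (hL _).comp ih

/-- `bad k x` says that the k-th map may fail to be injective over `x`. As first coordinates never
change, it can be tested at the starting point. -/
lemma iter_eq_iter {bad : ℕ → UnitAddCircle → Prop} (hL1 : ∀ k u, (L k u).1 = u.1)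
    (hL : ∀ k u v, L k u = L k v → u = v ∨ bad k u.1) {n : ℕ} {u v : Torus}
    (h : iter L n u = iter L n v) : u = v ∨ ∃ k ≤ n, bad k u.1 := by
  induction n with
  | zero => exact (hL 0 u v h).imp_right fun h => ⟨0, le_rfl, h⟩
  | succ n ih =>
    rcases hL _ _ _ h with h | h
    · exact (ih h).imp_right fun ⟨k, hk, h⟩ => ⟨k, hk.trans (Nat.le_succ n), h⟩
    · rw [iter_fst hL1] at h
      exact Or.inr ⟨n + 1, le_rfl, h⟩

lemma iter_congr {L' : ℕ → Torus → Torus} {n : ℕ} (h : ∀ k ≤ n, L k = L' k) :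
    iter L n = iter L' n := by
  induction n with
  | zero => exact h 0 le_rfl
  | succ n ih =>
    simp only [iter]
    rw [ih fun k hk => h k (hk.trans (Nat.le_succ n)), h (n + 1) le_rfl]

end Iter

/-! ### Finite products and their reorderings. -/

namespace Choices
variable (D : Choices) {α : ℕ → ℝ}

/-- The squares are nondegenerate and embedded in the torus. -/
structure SmallSquares (δ : ℕ → ℝ) : Prop where
  pos : ∀ n, 0 < δ n
  lt_half : ∀ n, δ n < 1 / 2

/-- The geometric part of admissibility. -/
structure Tame (δ : ℕ → ℝ) : Prop extends SmallSquares δ where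
  disjoint : ∀ m n, m < n → n ≤ m + 5 → Disjoint (D.A δ m) (D.A δ n)
  avoid : ∀ m n, m < n → ∀ u ∈ D.A δ n, u.1 ≠ (D.z m).1

/-- `Λ_{π(n)} ∘ ⋯ ∘ Λ_{π(0)}`. -/
def PhiPerm (α δ : ℕ → ℝ) (π : ℕ → ℕ) : ℕ → Torus → Torus := iter fun k => D.Lam α δ (π k)

/-- `(Λ_{π(n)} ∘ ⋯ ∘ Λ_{π(0)})⁻¹ ∘ R ∘ Φ_n` on `X`. -/
def GamPerm (α δ : ℕ → ℝ) (π : ℕ → ℕ) (R : Torus → Torus) (n : ℕ) (u : Torus) : Torus :=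
  Function.invFunOn (D.PhiPerm α δ π n) D.X (R (D.Phi α δ n u))

/-- `Λ_{π(n)} ∘ ⋯ ∘ Λ_{π(0)}` with the factor `Λ_{π(m)}` omitted. -/
def PhiOmit (α δ : ℕ → ℝ) (π : ℕ → ℕ) (m : ℕ) : ℕ → Torus → Torus :=
  iter fun k => if k = m then id else D.Lam α δ (π k)

lemma PhiPerm_fst (δ : ℕ → ℝ) (π : ℕ → ℕ) (n : ℕ) (u : Torus) :
    (D.PhiPerm α δ π n u).1 = u.1 := iter_fst (fun _ _ => D.Lam_fst _ _ _) n u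

lemma Phi_fst (δ : ℕ → ℝ) (n : ℕ) (u : Torus) :
    (D.Phi α δ n u).1 = u.1 := iter_fst (fun _ _ => D.Lam_fst _ _ _) n u

lemma PhiOmit_fst (δ : ℕ → ℝ) (π : ℕ → ℕ) (m n : ℕ) (u : Torus) :
    (D.PhiOmit α δ π m n u).1 = u.1 := by
  refine iter_fst (fun k u => ?_) n u
  split_ifs
  exacts [rfl, D.Lam_fst _ _ _]

lemma Phi_mem_X {δ : ℕ → ℝ} {n : ℕ} {u : Torus} : D.Phi α δ n u ∈ D.X ↔ u ∈ D.X :=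
  D.mem_X_congr (D.Phi_fst δ n u)

section Small
variable {D} (hα : ∀ n, α n ∈ Icc (0 : ℝ) 1) {δ : ℕ → ℝ} (hδ : SmallSquares δ)
include hα hδ

lemma SmallSquares.continuous_Phi (n : ℕ) : Continuous (D.Phi α δ n) :=
  continuous_iter (fun k => D.continuous_Lam hα (hδ.pos k) (hδ.lt_half k)) n

lemma SmallSquares.Phi_surjective (n : ℕ) : Function.Surjective (D.Phi α δ n) :=
  iter_surjective (fun k => D.Lam_surjective hα (hδ.pos k) (hδ.lt_half k)) n

lemma SmallSquares.continuous_PhiPerm (π : ℕ → ℕ) (n : ℕ) : Continuous (D.PhiPerm α δ π n) :=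
  continuous_iter (fun k => D.continuous_Lam hα (hδ.pos (π k)) (hδ.lt_half (π k))) n

lemma SmallSquares.PhiPerm_surjective (π : ℕ → ℕ) (n : ℕ) : Function.Surjective (D.PhiPerm α δ π n) :=
  iter_surjective (fun k => D.Lam_surjective hα (hδ.pos (π k)) (hδ.lt_half (π k))) n

lemma SmallSquares.continuous_PhiOmit (π : ℕ → ℕ) (m n : ℕ) : Continuous (D.PhiOmit α δ π m n) := by
  refine continuous_iter (fun k => ?_) n
  split_ifs
  exacts [continuous_id, D.continuous_Lam hα (hδ.pos (π k)) (hδ.lt_half (π k))]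

lemma SmallSquares.PhiOmit_surjective (π : ℕ → ℕ) (m n : ℕ) :
    Function.Surjective (D.PhiOmit α δ π m n) := by
  refine iter_surjective (fun k => ?_) n
  split_ifs
  exacts [Function.surjective_id, D.Lam_surjective hα (hδ.pos (π k)) (hδ.lt_half (π k))]

lemma SmallSquares.PhiPerm_eq {π : ℕ → ℕ} {n : ℕ} {u v : Torus}
    (h : D.PhiPerm α δ π n u = D.PhiPerm α δ π n v) : u = v ∨ ∃ k ≤ n, u.1 = (D.z (π k)).1 :=
  iter_eq_iter (bad := fun k x => x = (D.z (π k)).1) (fun _ _ => D.Lam_fst _ _ _)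
    (fun k _ _ h => (D.Lam_eq_Lam hα (hδ.pos (π k)) (hδ.lt_half (π k)) h).imp_right
      fun h => h.1) h

lemma SmallSquares.PhiOmit_eq {π : ℕ → ℕ} {m n : ℕ} {u v : Torus}
    (h : D.PhiOmit α δ π m n u = D.PhiOmit α δ π m n v) :
    u = v ∨ ∃ k ≤ n, k ≠ m ∧ u.1 = (D.z (π k)).1 := by
  refine iter_eq_iter (bad := fun k x => k ≠ m ∧ x = (D.z (π k)).1) ?_ ?_ h
  · intro k u
    split_ifs
    exacts [rfl, D.Lam_fst _ _ _]
  · intro k u v h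
    split_ifs at h with hk
    · exact Or.inl h
    · exact (D.Lam_eq_Lam hα (hδ.pos (π k)) (hδ.lt_half (π k)) h).imp_right fun h => ⟨hk, h.1⟩

lemma SmallSquares.PhiPerm_injOn (π : ℕ → ℕ) (n : ℕ) : InjOn (D.PhiPerm α δ π n) D.X := fun _ hu _ _ h =>
  (hδ.PhiPerm_eq hα h).resolve_right fun ⟨k, _, hk⟩ => hu (π k) hk

lemma SmallSquares.PhiPerm_surjOn (π : ℕ → ℕ) (n : ℕ) : SurjOn (D.PhiPerm α δ π n) D.X D.X := by
  intro w hw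
  obtain ⟨u, rfl⟩ := hδ.PhiPerm_surjective (D := D) hα π n w
  exact ⟨u, (D.mem_X_congr (D.PhiPerm_fst δ π n u)).1 hw, rfl⟩

end Small

/-! ### Commuting factors and continuous extension of the conjugated maps. -/

section Tame
variable {D} (hα : ∀ n, α n ∈ Icc (0 : ℝ) 1) {δ : ℕ → ℝ} (hδ : D.Tame δ)

lemma Tame.z_fixed (hδ : D.Tame δ) {m n : ℕ} (h : m < n) : D.Lam α δ n (D.z m) = D.z m :=
  D.Lam_of_notMem fun h' => hδ.avoid m n h _ h' rfl

lemma Tame.Phi_z_of_le (hδ : D.Tame δ) {m n k : ℕ} (hm : m ≤ n) (hk : n ≤ k) {u : Torus}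
    (h : D.Phi α δ n u = D.z m) : D.Phi α δ k u = D.z m := by
  induction k, hk using Nat.le_induction with
  | base => exact h
  | succ k hk ih =>
    change D.Lam α δ (k + 1) (D.Phi α δ k u) = _
    rw [ih, hδ.z_fixed (by omega)]

section
include hα hδ

/-- A collapse at stage m happens over `z m`, and later squares miss that point, so the collapsed
image stays there. -/
lemma Tame.Phi_eq {n : ℕ} {u v : Torus} (h : D.Phi α δ n u = D.Phi α δ n v) :
    u = v ∨ ∃ m ≤ n, D.Phi α δ n u = D.z m := by
  induction n with
  | zero =>
    exact (D.Lam_eq_Lam hα (hδ.pos 0) (hδ.lt_half 0) h).imp_right fun h => ⟨0, le_rfl, h.2⟩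
  | succ n ih =>
    rcases D.Lam_eq_Lam hα (hδ.pos _) (hδ.lt_half _) h with h | h
    · refine (ih h).imp_right fun ⟨m, hm, h⟩ => ⟨m, hm.trans (Nat.le_succ n), ?_⟩
      change D.Lam α δ (n + 1) (D.Phi α δ n u) = _
      rw [h, hδ.z_fixed (by omega)]
    · exact Or.inr ⟨n + 1, le_rfl, h.2⟩

/-- Each map preserves its own square and is the identity off it. -/
lemma Tame.Lam_comm {m n : ℕ} (h : Disjoint (D.A δ m) (D.A δ n)) (u : Torus) :
    D.Lam α δ m (D.Lam α δ n u) = D.Lam α δ n (D.Lam α δ m u) := by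
  have aux : ∀ m n, Disjoint (D.A δ m) (D.A δ n) → ∀ u ∈ D.A δ n,
      D.Lam α δ m (D.Lam α δ n u) = D.Lam α δ n (D.Lam α δ m u) := by
    intro m n h u hu
    rw [D.Lam_of_notMem (disjoint_right.1 h (D.Lam_mem_A hα (hδ.pos n) (hδ.lt_half n) hu)),
      D.Lam_of_notMem (disjoint_right.1 h hu)]
  by_cases hn : u ∈ D.A δ n
  · exact aux m n h u hn
  by_cases hm : u ∈ D.A δ m
  · exact (aux n m h.symm u hm).symm
  · rw [D.Lam_of_notMem hn, D.Lam_of_notMem hm, D.Lam_of_notMem hn]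

end

lemma Tame.disjoint_of_near (hδ : D.Tame δ) {m n : ℕ} (h : m ≠ n) (h1 : n ≤ m + 5)
    (h2 : m ≤ n + 5) : Disjoint (D.A δ m) (D.A δ n) := by
  rcases h.lt_or_gt with h | h
  · exact hδ.disjoint m n h h1
  · exact (hδ.disjoint n m h h2).symm

lemma Tame.eventually_notMem (hδ : D.Tame δ) {m n : ℕ} (h : m < n) :
    ∀ᶠ x in 𝓝 (D.z m).1, ∀ u : Torus, u.1 = x → u ∉ D.A δ n := by
  have h1 : δ n < ‖(D.z m).1 - (D.z n).1‖ := by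
    by_contra! h1
    refine hδ.avoid m n h ((D.z m).1, (D.z n).2) (D.mem_A.2 ⟨h1, ?_⟩) rfl
    simpa using (hδ.pos n).le
  have hc : Continuous fun x : UnitAddCircle => ‖x - (D.z n).1‖ := by fun_prop
  filter_upwards [hc.continuousAt.eventually (lt_mem_nhds h1)] with x hx u hu hA
  have := (D.mem_A.1 hA).1
  rw [hu] at this
  linarith

variable {π : ℕ → ℕ} {R : Torus → Torus} {c : Torus} (hR : D.IsShift π R c)
include hα hδ hR

/-- If `π m < π k`, the square of `π k` misses all fibres near that of `z (π m)`, so its map is the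
identity there. If `π` reverses the order, the indices differ by at most 5 and the squares are
disjoint. -/
lemma Tame.eventually_comm {m k : ℕ} (hk : m < k) :
    ∀ᶠ x in 𝓝 (D.z (π m)).1, ∀ u : Torus, u.1 = x →
      D.Lam α δ (π k) (D.Lam α δ (π m) u) = D.Lam α δ (π m) (D.Lam α δ (π k) u) := by
  rcases lt_or_ge (π m) (π k) with h | h
  · filter_upwards [hδ.eventually_notMem h] with x hx u hu
    rw [D.Lam_of_notMem (hx u hu), D.Lam_of_notMem (hx _ (by rwa [D.Lam_fst]))]
  · have hne : π k ≠ π m := fun h => by have := hR.inj h; omega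
    have := hR.order m k hk (lt_of_le_of_ne h hne)
    exact Eventually.of_forall fun x u _ =>
      hδ.Lam_comm hα (hδ.disjoint_of_near hne this (by omega)) u

/-- Near the fibre of `z_{π(m)}` the factor `Λ_{π(m)}` can be moved to the front. -/
lemma Tame.eventually_PhiPerm_eq {m n : ℕ} (hm : m ≤ n) :
    ∀ᶠ x in 𝓝 (D.z (π m)).1, ∀ u : Torus, u.1 = x →
      D.PhiPerm α δ π n u = D.Lam α δ (π m) (D.PhiOmit α δ π m n u) := by
  induction n, hm using Nat.le_induction with
  | base =>
    refine Eventually.of_forall fun x u _ => ?_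
    cases m with
    | zero => simp [PhiPerm, PhiOmit, iter]
    | succ m =>
      have : iter (fun k => D.Lam α δ (π k)) m =
          iter (fun k => if k = m + 1 then id else D.Lam α δ (π k)) m :=
        iter_congr fun k hk => by rw [if_neg (by omega)]
      simp [PhiPerm, PhiOmit, iter, this]
  | succ n hm ih =>
    filter_upwards [ih, hδ.eventually_comm hα hR (Nat.lt_succ_of_le hm)] with x h1 h2 u hu
    change D.Lam α δ (π (n + 1)) (D.PhiPerm α δ π n u) = D.Lam α δ (π m)
      ((if n + 1 = m then id else D.Lam α δ (π (n + 1))) (D.PhiOmit α δ π m n u))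
    rw [if_neg (by omega), h1 u hu, h2 _ (by rwa [D.PhiOmit_fst])]

lemma Tame.GamPerm_spec {n : ℕ} {u : Torus} (hu : u ∈ D.X) :
    D.GamPerm α δ π R n u ∈ D.X ∧
      D.PhiPerm α δ π n (D.GamPerm α δ π R n u) = R (D.Phi α δ n u) := by
  have h := hδ.PhiPerm_surjOn hα π n (hR.mem_X.2 (D.Phi_mem_X.2 hu) : R (D.Phi α δ n u) ∈ D.X)
  exact ⟨Function.invFunOn_mem h, Function.invFunOn_eq h⟩

lemma Tame.GamPerm_fst {n : ℕ} {u : Torus} (hu : u ∈ D.X) :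
    (D.GamPerm α δ π R n u).1 = u.1 + c.1 := by
  have := congrArg Prod.fst (hδ.GamPerm_spec hα hR (n := n) hu).2
  rwa [D.PhiPerm_fst, hR.apply, Prod.fst_add, D.Phi_fst] at this

/-- At most one factor is singular on the fibre of `p`. Moved to the front of both products, it
cancels up to the continuous map `B`. What remains determines the value by an equation with a unique
solution at `p`, and compactness turns uniqueness into convergence. -/
lemma Tame.exists_tendsto_GamPerm (n : ℕ) (p : Torus) :
    ∃ y, Tendsto (D.GamPerm α δ π R n) (𝓝[D.X] p) (𝓝 y) := by
  by_cases hp : ∃ m ≤ n, p.1 = (D.z m).1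
  · obtain ⟨m, hm, hp⟩ := hp
    obtain ⟨B, hB, hB1, hBe⟩ := D.exists_Lam_conj hα (hδ.pos m) (hδ.lt_half m) (hδ.pos (π m))
      (hδ.lt_half (π m)) (hR.z m)
    obtain ⟨y, hy⟩ := hδ.PhiOmit_surjective hα π m n (B (R (D.PhiOmit α δ id m n p)))
    -- The omitted factor is the only one that could be singular on this fibre, so the remaining
    -- product is injective over it.
    have hu : ∀ u, D.PhiOmit α δ π m n u = D.PhiOmit α δ π m n y → u = y := by
      intro u hu
      refine (hδ.PhiOmit_eq hα hu).resolve_right ?_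
      rintro ⟨k, -, hkm, hk⟩
      have h1 := congrArg Prod.fst hu
      rw [hy, D.PhiOmit_fst, hB1, hR.apply, Prod.fst_add, D.PhiOmit_fst, hk, hp, ← hR.z_fst] at h1
      exact hkm (hR.inj (D.z_fst_injective h1))
    refine ⟨y, Tendsto.mono_right ?_ (comap_nhds_le_of_unique (hδ.continuous_PhiOmit hα π m n) hu)⟩
    rw [tendsto_comap_iff, hy]
    have hcont : Continuous fun u => B (R (D.PhiOmit α δ id m n u)) :=
      hB.comp (hR.continuous.comp (hδ.continuous_PhiOmit hα id m n))
    refine ((hcont.tendsto p).mono_left nhdsWithin_le_nhds).congr' ?_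
    have e1 : ∀ᶠ u : Torus in 𝓝 p, ∀ v : Torus, v.1 = u.1 →
        D.Phi α δ n v = D.Lam α δ m (D.PhiOmit α δ id m n v) := by
      have h := hδ.eventually_PhiPerm_eq hα D.isShift_id hm
      rw [id, ← hp] at h
      exact continuous_fst.continuousAt.eventually h
    have e2 : ∀ᶠ u : Torus in 𝓝 p, ∀ v : Torus, v.1 = u.1 + c.1 →
        D.PhiPerm α δ π n v = D.Lam α δ (π m) (D.PhiOmit α δ π m n v) := by
      have h := hδ.eventually_PhiPerm_eq hα hR hm
      rw [hR.z_fst, ← hp] at h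
      have hc : Continuous fun u : Torus => u.1 + c.1 := by fun_prop
      exact hc.continuousAt.eventually h
    have e3 : ∀ᶠ u : Torus in 𝓝 p, ‖u.1 - (D.z m).1‖ < min (δ m) (δ (π m)) := by
      have hc : Continuous fun u : Torus => ‖u.1 - (D.z m).1‖ := by fun_prop
      refine hc.continuousAt.eventually (gt_mem_nhds ?_)
      simp only [hp, sub_self, norm_zero]
      exact lt_min (hδ.pos _) (hδ.pos _)
    filter_upwards [self_mem_nhdsWithin, mem_nhdsWithin_of_mem_nhds e1,
      mem_nhdsWithin_of_mem_nhds e2, mem_nhdsWithin_of_mem_nhds e3] with u hu h1 h2 h3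
    obtain ⟨g1, g2⟩ := hδ.GamPerm_spec hα hR (n := n) hu
    have g3 := hδ.GamPerm_fst hα hR (n := n) hu
    rw [h2 _ g3, h1 u rfl, hR.apply, hBe _ (by rw [D.PhiOmit_fst]; exact h3.le)] at g2
    -- The singular factor may be cancelled because the value of `GamPerm` lies in `X`, off its
    -- singular fibre.
    rcases D.Lam_eq_Lam hα (hδ.pos _) (hδ.lt_half _) g2 with h | h
    · rw [Function.comp_apply, h, hR.apply]
    · rw [D.PhiOmit_fst] at h
      exact absurd h.1 (g1 _)
  · push Not at hp
    obtain ⟨y, hy⟩ := hδ.PhiPerm_surjective hα π n (R (D.Phi α δ n p))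
    have hu : ∀ u, D.PhiPerm α δ π n u = D.PhiPerm α δ π n y → u = y := by
      intro u hu
      refine (hδ.PhiPerm_eq hα hu).resolve_right ?_
      rintro ⟨k, hk, h⟩
      have h1 := congrArg Prod.fst hu
      rw [hy, D.PhiPerm_fst, hR.apply, Prod.fst_add, D.Phi_fst, h, hR.z_fst, add_left_inj] at h1
      exact hp k hk h1.symm
    refine ⟨y, Tendsto.mono_right ?_ (comap_nhds_le_of_unique (hδ.continuous_PhiPerm hα π n) hu)⟩
    rw [tendsto_comap_iff, hy]
    have hcont := hR.continuous.comp (hδ.continuous_Phi (D := D) hα n)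
    refine ((hcont.tendsto p).mono_left nhdsWithin_le_nhds).congr' ?_
    filter_upwards [self_mem_nhdsWithin] with u hu
    exact (hδ.GamPerm_spec hα hR (n := n) hu).2.symm

/-- The continuous extension lives on a compact space. -/
lemma Tame.uniformContinuousOn_GamPerm (n : ℕ) :
    UniformContinuousOn (D.GamPerm α δ π R n) D.X := by
  have h1 := continuous_extendFrom D.dense_X (hδ.exists_tendsto_GamPerm hα hR n)
  have h2 := (CompactSpace.uniformContinuous_of_continuous h1).uniformContinuousOn (s := D.X)
  have hc : ContinuousOn (D.GamPerm α δ π R n) D.X := by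
    intro p hp
    obtain ⟨y, hy⟩ := hδ.exists_tendsto_GamPerm hα hR n p
    have := tendsto_nhds_unique (tendsto_pure_nhds (D.GamPerm α δ π R n) p)
      (hy.mono_left (pure_le_nhdsWithin hp))
    rwa [← this] at hy
  refine h2.congr fun p hp => ?_
  exact extendFrom_eq (D.dense_X p) (hc p hp)

end Tame
end Choices

/-! ### Uniform convergence of the conjugated maps. -/

lemma dist_add_le_of_geometric {a : ℕ → Torus} {C : ℝ} {N : ℕ}
    (h : ∀ n ≥ N, dist (a (n + 1)) (a n) ≤ C / 2 ^ n) {n : ℕ} (hn : N ≤ n) (k : ℕ) :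
    dist (a (n + k)) (a n) ≤ 2 * C / 2 ^ n - 2 * C / 2 ^ (n + k) := by
  induction k with
  | zero => simp
  | succ k ih =>
    have h1 := h (n + k) (by omega)
    have h2 := dist_triangle (a (n + k + 1)) (a (n + k)) (a n)
    have h3 : C / 2 ^ (n + k) + 2 * C / 2 ^ (n + (k + 1)) = 2 * C / 2 ^ (n + k) := by
      rw [← add_assoc, pow_succ]; field_simp; ring
    rw [← add_assoc] at h3 ⊢
    linarith

lemma uniformCauchySeqOn_of_geometric {β : Type*} {f : ℕ → β → Torus} {S : Set β} {C : ℝ} {N : ℕ}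
    (hC : 0 ≤ C) (h : ∀ n ≥ N, ∀ u ∈ S, dist (f (n + 1) u) (f n u) ≤ C / 2 ^ n) :
    UniformCauchySeqOn f atTop S := by
  rw [Metric.uniformCauchySeqOn_iff]
  intro e he
  have ht : Tendsto (fun n : ℕ => 2 * C / 2 ^ n) atTop (𝓝 0) :=
    tendsto_const_nhds.div_atTop (tendsto_pow_atTop_atTop_of_one_lt one_lt_two)
  obtain ⟨M, hM1, hM2⟩ :=
    ((ht.eventually (gt_mem_nhds (half_pos he))).and (eventually_ge_atTop N)).exists
  have key : ∀ m ≥ M, ∀ u ∈ S, dist (f m u) (f M u) < e / 2 := by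
    intro m hm u hu
    obtain ⟨k, rfl⟩ := Nat.exists_eq_add_of_le hm
    have h1 := dist_add_le_of_geometric (a := fun n => f n u) (fun n hn => h n hn u hu) hM2 k
    have : 0 ≤ 2 * C / 2 ^ (M + k) := by positivity
    linarith
  refine ⟨M, fun m hm n hn u hu => ?_⟩
  linarith [key m hm u hu, key n hn u hu, dist_triangle_right (f m u) (f n u) (f M u)]

namespace Choices
variable {D : Choices} {α : ℕ → ℝ}

/-- From some index on, `π` alternates between `n ↦ n + 2` and `n ↦ n - 2`, starting at `s + 2`, and
its values up to `s + 1` are `0, …, s, s + 2`. -/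
structure IsZigzag (D : Choices) (α δ : ℕ → ℝ) (π : ℕ → ℕ) (s : ℕ) : Prop where
  base : ∀ u, D.PhiPerm α δ π (s + 1) u = D.Lam α δ (s + 2) (D.Phi α δ s u)
  up : ∀ j, π (2 * j + s + 2) = 2 * j + s + 4
  down : ∀ j, π (2 * j + s + 3) = 2 * j + s + 1

section
variable (hα : ∀ n, α n ∈ Icc (0 : ℝ) 1) {δ : ℕ → ℝ} (hδ : D.Tame δ)
include hα hδ

lemma Tame.isZigzag_sigma : D.IsZigzag α δ sigma 0 where
  base u := (hδ.Lam_comm hα (hδ.disjoint 0 2 (by omega) (by omega)) u)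
  up j := sigma_even (j + 1)
  down j := sigma_odd j

lemma Tame.isZigzag_tau : D.IsZigzag α δ tau 1 where
  base u := by
    change D.Lam α δ 0 (D.Lam α δ 3 (D.Lam α δ 1 u)) = D.Lam α δ 3 (D.Lam α δ 1 (D.Lam α δ 0 u))
    rw [hδ.Lam_comm hα (hδ.disjoint 0 3 (by omega) (by omega)),
      hδ.Lam_comm hα (hδ.disjoint 0 1 (by omega) (by omega))]
  up j := tau_odd (j + 1)
  down j := tau_even (j + 1)

variable {π : ℕ → ℕ} {s : ℕ} (hπ : D.IsZigzag α δ π s)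
include hπ

/-- At these indices the reordered product has one factor more than `Phi (2 * j + s)`: every two
steps supply the missing index and one new index ahead, and neighbouring factors commute. Both the
Cauchy estimate and the semiconjugacy rest on this. -/
lemma Tame.PhiPerm_zigzag (j : ℕ) (u : Torus) :
    D.PhiPerm α δ π (2 * j + s + 1) u =
      D.Lam α δ (2 * j + s + 2) (D.Phi α δ (2 * j + s) u) := by
  induction j with
  | zero => simpa using hπ.base u
  | succ j ih =>
    have e : 2 * (j + 1) + s + 1 = 2 * j + s + 1 + 1 + 1 := by ring
    have e2 : 2 * (j + 1) + s = 2 * j + s + 1 + 1 := by ring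
    rw [e, e2]
    change D.Lam α δ (π (2 * j + s + 3)) (D.Lam α δ (π (2 * j + s + 2))
      (D.PhiPerm α δ π (2 * j + s + 1) u)) = D.Lam α δ (2 * j + s + 4)
        (D.Lam α δ (2 * j + s + 2) (D.Lam α δ (2 * j + s + 1) (D.Phi α δ (2 * j + s) u)))
    rw [ih, hπ.up, hπ.down, hδ.Lam_comm hα (hδ.disjoint _ _ (by omega) (by omega)),
      hδ.Lam_comm hα (m := 2 * j + s + 1) (n := 2 * j + s + 2)
        (hδ.disjoint _ _ (by omega) (by omega))]

lemma Tame.PhiPerm_zigzag_succ (j : ℕ) (u : Torus) :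
    D.PhiPerm α δ π (2 * j + s + 2) u =
      D.Lam α δ (2 * j + s + 4) (D.Lam α δ (2 * j + s + 2) (D.Phi α δ (2 * j + s) u)) := by
  change D.Lam α δ (π (2 * j + s + 2)) (D.PhiPerm α δ π (2 * j + s + 1) u) = _
  rw [hδ.PhiPerm_zigzag hα hπ, hπ.up]

end

/-- The quantitative requirements on the squares from which the convergence of the conjugated maps
follows. -/
structure Fine (D : Choices) (α δ : ℕ → ℝ) : Prop extends D.Tame δ where
  anti : Antitone δ
  sep : ∀ n, 2 * δ n < dist (D.z n).1 (D.z (n + 2)).1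
  small : ∀ r k j, k < r → k < j → j ≤ r + 2 → ∀ u v : Torus,
    dist (D.Phi α δ k u) (D.z j) ≤ δ r → dist (D.Phi α δ k v) (D.z j) ≤ δ r → dist u v < 1 / 2 ^ r

lemma Tame.dist_Lam_le_of_mem (hδ : D.Tame δ) (hα : ∀ n, α n ∈ Icc (0 : ℝ) 1) {n : ℕ} {e : ℝ}
    (he : δ n ≤ e) {u : Torus} : dist (D.Lam α δ n u) (D.z n) ≤ e ↔ dist u (D.z n) ≤ e := by
  by_cases h : u ∈ D.A δ n
  · have h2 := D.Lam_mem_A hα (hδ.pos n) (hδ.lt_half n) h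
    rw [A_eq, Metric.mem_closedBall] at h h2
    exact ⟨fun _ => h.trans he, fun _ => h2.trans he⟩
  · rw [D.Lam_of_notMem h]

section
variable (hα : ∀ n, α n ∈ Icc (0 : ℝ) 1) {δ : ℕ → ℝ}
  {π : ℕ → ℕ} {R : Torus → Torus} {c : Torus} (hR : D.IsShift π R c)
include hα hR

/-- Consecutive conjugated maps differ only where both values lie in the preimage of a small
square. -/
lemma Tame.dist_GamPerm_succ_le (hδ : D.Tame δ) {n : ℕ} {r e : ℝ} (he : 0 ≤ e) (h1 : δ (n + 1) ≤ r)
    (h2 : δ (π (n + 1)) ≤ r)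
    (hs : ∀ u v, dist (D.PhiPerm α δ π n u) (D.z (π (n + 1))) ≤ r →
      dist (D.PhiPerm α δ π n v) (D.z (π (n + 1))) ≤ r → dist u v ≤ e) {u : Torus}
    (hu : u ∈ D.X) : dist (D.GamPerm α δ π R (n + 1) u) (D.GamPerm α δ π R n u) ≤ e := by
  obtain ⟨a1, a2⟩ := hδ.GamPerm_spec hα hR (n := n) hu
  obtain ⟨b1, b2⟩ := hδ.GamPerm_spec hα hR (n := n + 1) hu
  change D.Lam α δ (π (n + 1)) (D.PhiPerm α δ π n _) = R (D.Lam α δ (n + 1) (D.Phi α δ n u)) at b2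
  set v := D.GamPerm α δ π R n u
  set v' := D.GamPerm α δ π R (n + 1) u
  have hd : ∀ p, dist (R p) (D.z (π (n + 1))) = dist p (D.z (n + 1)) := fun p => by
    rw [hR.apply, hR.z, dist_add_right]
  -- In the ball of radius `r`, which both new maps preserve, the smallness hypothesis applies to
  -- both values. Outside it neither new factor acts, and injectivity on `X` makes the two values
  -- equal.
  by_cases hw : dist (R (D.Phi α δ n u)) (D.z (π (n + 1))) ≤ r
  · refine hs _ _ ?_ (by rwa [a2])
    rw [← hδ.dist_Lam_le_of_mem hα h2, b2, hd, hδ.dist_Lam_le_of_mem hα h1, ← hd]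
    exact hw
  · have hA : D.Phi α δ n u ∉ D.A δ (n + 1) := fun h => by
      rw [A_eq, Metric.mem_closedBall] at h
      rw [hd] at hw
      exact hw (h.trans h1)
    rw [D.Lam_of_notMem hA] at b2
    have hB : D.PhiPerm α δ π n v' ∉ D.A δ (π (n + 1)) := fun h => by
      have := D.Lam_mem_A hα (hδ.pos _) (hδ.lt_half _) h
      rw [b2, A_eq, Metric.mem_closedBall] at this
      exact hw (this.trans h2)
    rw [D.Lam_of_notMem hB, ← a2] at b2
    rw [hδ.PhiPerm_injOn hα π n b1 a1 b2, dist_self]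
    exact he

/-- Each step adds the factor of some `z i`, and the preimage of a small ball about `z i` under the
reordered product must be small. Its surplus factors over `Phi (2 * j + s)` do not interfere: `sep`
keeps them away when the index goes up, disjointness when it goes down. Then `small` applies to
`Phi`. -/
lemma Fine.uniformCauchySeqOn_GamPerm (hδ : D.Fine α δ) {s : ℕ} (hπ : D.IsZigzag α δ π s) :
    UniformCauchySeqOn (D.GamPerm α δ π R) atTop D.X := by
  have hT := hδ.toTame
  -- The constant 2 is needed for downward steps, where the radius is `δ (n - 1)`.
  refine uniformCauchySeqOn_of_geometric (C := 2) (N := s + 1) (by norm_num) ?_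
  intro n hn u hu
  obtain ⟨j, rfl | rfl⟩ : ∃ j, n = 2 * j + s + 1 ∨ n = 2 * j + s + 2 := ⟨(n - s - 1) / 2, by omega⟩
  · refine hT.dist_GamPerm_succ_le hα hR (r := δ (2 * j + s + 2)) (by positivity) le_rfl
      (by rw [hπ.up]; exact hδ.anti (by omega)) ?_ hu
    rw [hπ.up]
    have key : ∀ v, dist (D.PhiPerm α δ π (2 * j + s + 1) v) (D.z (2 * j + s + 4)) ≤
        δ (2 * j + s + 2) → dist (D.Phi α δ (2 * j + s) v) (D.z (2 * j + s + 4)) ≤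
        δ (2 * j + s + 2) := by
      intro v hv
      rw [hT.PhiPerm_zigzag hα hπ] at hv
      by_cases hA : D.Phi α δ (2 * j + s) v ∈ D.A δ (2 * j + s + 2)
      · have h1 := D.Lam_mem_A hα (hT.pos _) (hT.lt_half _) hA
        rw [A_eq, Metric.mem_closedBall] at h1
        have h2 := hδ.sep (2 * j + s + 2)
        have h3 := dist_triangle_left (D.z (2 * j + s + 2)) (D.z (2 * j + s + 4))
          (D.Lam α δ (2 * j + s + 2) (D.Phi α δ (2 * j + s) v))
        have h4 : dist (D.z (2 * j + s + 2)).1 (D.z (2 * j + s + 2 + 2)).1 ≤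
          dist (D.z (2 * j + s + 2)) (D.z (2 * j + s + 4)) := le_max_left _ _
        linarith
      · rwa [D.Lam_of_notMem hA] at hv
    intro v w hv hw
    refine (hδ.small _ _ _ (by omega) (by omega) (by omega) v w (key v hv) (key w hw)).le.trans ?_
    have : (2 : ℝ) ^ (2 * j + s + 2) = 2 ^ (2 * j + s + 1) * 2 := pow_succ _ _
    rw [this]
    gcongr
    · norm_num
    · linarith [show (0 : ℝ) < 2 ^ (2 * j + s + 1) by positivity]
  · refine hT.dist_GamPerm_succ_le hα hR (r := δ (2 * j + s + 1)) (by positivity)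
      (hδ.anti (by omega)) (by rw [hπ.down]) ?_ hu
    rw [hπ.down]
    have key : ∀ v, dist (D.PhiPerm α δ π (2 * j + s + 2) v) (D.z (2 * j + s + 1)) ≤
        δ (2 * j + s + 1) → dist (D.Phi α δ (2 * j + s) v) (D.z (2 * j + s + 1)) ≤
        δ (2 * j + s + 1) := by
      intro v hv
      rw [hT.PhiPerm_zigzag_succ hα hπ] at hv
      have d1 := hT.disjoint (2 * j + s + 1) (2 * j + s + 4) (by omega) (by omega)
      have d2 := hT.disjoint (2 * j + s + 1) (2 * j + s + 2) (by omega) (by omega)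
      have back : ∀ k, Disjoint (D.A δ (2 * j + s + 1)) (D.A δ k) → ∀ q,
          D.Lam α δ k q ∈ D.A δ (2 * j + s + 1) → q ∈ D.A δ (2 * j + s + 1) := by
        intro k hk q hq
        by_cases hA : q ∈ D.A δ k
        · exact absurd (D.Lam_mem_A hα (hT.pos _) (hT.lt_half _) hA) (disjoint_left.1 hk hq)
        · rwa [D.Lam_of_notMem hA] at hq
      simp only [A_eq, Metric.mem_closedBall] at back d1 d2
      exact back _ d2 _ (back _ d1 _ hv)
    intro v w hv hw
    refine (hδ.small _ _ _ (by omega) (by omega) (by omega) v w (key v hv) (key w hw)).le.trans ?_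
    have : (2 : ℝ) ^ (2 * j + s + 2) = 2 ^ (2 * j + s + 1) * 2 := pow_succ _ _
    rw [this, div_mul_eq_div_div_swap]
    norm_num

end
end Choices

/-! ### Passage to the limit. -/

lemma torusDist_eq_zero {p q : Torus} (h : torusDist p q = 0) : p = q := by
  have h1 := (Real.sqrt_eq_zero (by positivity)).1 h
  have h2 : dist p.1 q.1 = 0 := by nlinarith [sq_nonneg (dist p.1 q.1), sq_nonneg (dist p.2 q.2)]
  have h3 : dist p.2 q.2 = 0 := by nlinarith [sq_nonneg (dist p.1 q.1), sq_nonneg (dist p.2 q.2)]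
  exact Prod.ext (dist_eq_zero.1 h2) (dist_eq_zero.1 h3)

lemma torusDist_self (p : Torus) : torusDist p p = 0 := by simp [torusDist]

lemma torusDist_nonneg (p q : Torus) : 0 ≤ torusDist p q := Real.sqrt_nonneg _

lemma continuous_torusDist : Continuous fun q : Torus × Torus => torusDist q.1 q.2 := by
  unfold torusDist
  fun_prop

/-- A uniformly Cauchy sequence of maps on a dense set whose members have limits everywhere is the
restriction of a sequence with a continuous limit. -/
lemma exists_continuous_limit {K Y : Type*} [TopologicalSpace K] [MetricSpace Y] [CompleteSpace Y]
    {f : ℕ → K → Y} {S : Set K} (hS : Dense S)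
    (hlim : ∀ n p, ∃ y, Tendsto (f n) (𝓝[S] p) (𝓝 y)) (hc : UniformCauchySeqOn f atTop S) :
    ∃ g : K → Y, Continuous g ∧ ∀ u ∈ S, Tendsto (fun n => f n u) atTop (𝓝 (g u)) := by
  set G : ℕ → K → Y := fun n => extendFrom S (f n)
  have hG : ∀ n, Continuous (G n) := fun n => continuous_extendFrom hS (hlim n)
  have hGe : ∀ n, ∀ u ∈ S, G n u = f n u := by
    intro n p hp
    obtain ⟨y, hy⟩ := hlim n p
    have := tendsto_nhds_unique (tendsto_pure_nhds (f n) p) (hy.mono_left (pure_le_nhdsWithin hp))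
    exact extendFrom_eq (hS p) (by rwa [this])
  have hGc : UniformCauchySeqOn G atTop univ := by
    rw [Metric.uniformCauchySeqOn_iff] at hc ⊢
    intro e he
    obtain ⟨N, hN⟩ := hc (e / 2) (half_pos he)
    refine ⟨N, fun m hm n hn u _ => ?_⟩
    -- A non-strict bound on the dense set `S` persists everywhere; halving `e` recovers the strict
    -- one.
    have hcl : IsClosed {u | dist (G m u) (G n u) ≤ e / 2} :=
      isClosed_le ((hG m).dist (hG n)) continuous_const
    have hsub : S ⊆ {u | dist (G m u) (G n u) ≤ e / 2} := fun u hu => by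
      rw [mem_ofPred_eq, hGe m u hu, hGe n u hu]
      exact (hN m hm n hn u hu).le
    have : dist (G m u) (G n u) ≤ e / 2 := hcl.closure_subset_iff.2 hsub (hS u)
    linarith
  have hp : ∀ u, ∃ y, Tendsto (fun n => G n u) atTop (𝓝 y) := fun u =>
    cauchySeq_tendsto_of_complete (hGc.cauchySeq (mem_univ u))
  choose g hg using hp
  have hu := hGc.tendstoUniformlyOn_of_tendsto fun u _ => hg u
  refine ⟨g, (tendstoUniformlyOn_univ.1 hu).continuous (Eventually.of_forall hG).frequently,
    fun u hu => ?_⟩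
  exact (hg u).congr fun n => hGe n u hu

/-! ### Consequences of admissibility. -/

namespace Choices
variable {D : Choices} {α δ : ℕ → ℝ}

/-- A square of half-side at least `1/2` is the whole torus. For `n = 0` the bound `lt_pow` gives
only `δ 0 < 1`. -/
lemma lt_half_of_disjoint {m n : ℕ} (hn : 0 ≤ δ n) (h : Disjoint (D.A δ m) (D.A δ n)) :
    δ m < 1 / 2 := by
  by_contra! hm
  have hz : D.z n ∈ D.A δ n := by rw [A_eq]; exact Metric.mem_closedBall_self hn
  refine disjoint_left.1 h (D.mem_A.2 ⟨?_, ?_⟩) hz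
  · refine le_trans ?_ hm
    rw [← abs_rep, abs_le]
    have := rep_mem ((D.z n).1 - (D.z m).1)
    constructor <;> linarith [this.1, this.2]
  · refine le_trans ?_ hm
    rw [← abs_rep, abs_le]
    have := rep_mem ((D.z n).2 - (D.z m).2)
    constructor <;> linarith [this.1, this.2]

lemma Admissible.tame (h : D.Admissible α δ) : D.Tame δ where
  pos := h.pos
  lt_half n := lt_half_of_disjoint (h.pos (n + 1)).le (h.disjoint n (n + 1) (by omega) (by omega))
  disjoint := h.disjoint
  avoid := h.avoid

lemma Admissible.tendsto_zero (h : D.Admissible α δ) : Tendsto δ atTop (𝓝 0) := by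
  refine squeeze_zero (fun n => (h.pos n).le) (fun n => (h.lt_pow n).le) ?_
  exact tendsto_const_nhds.div_atTop (tendsto_pow_atTop_atTop_of_one_lt one_lt_two)

section
variable (hα : ∀ n, α n ∈ Icc (0 : ℝ) 1) (h : D.Admissible α δ)
include hα h

lemma Admissible.exists_tendstoUniformly :
    ∃ Φ : Torus → Torus, TendstoUniformly (D.Phi α δ) Φ atTop := by
  have hc : UniformCauchySeqOn (D.Phi α δ) atTop univ := by
    refine uniformCauchySeqOn_of_geometric (C := 1) (N := 0) zero_le_one fun n _ u _ => ?_
    refine (D.dist_Lam_le hα (h.pos (n + 1)) (h.tame.lt_half (n + 1)) _).trans ?_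
    have := h.lt_pow (n + 1)
    rw [pow_succ, ← div_div] at this
    linarith
  have hp : ∀ u, ∃ y, Tendsto (fun n => D.Phi α δ n u) atTop (𝓝 y) := fun u =>
    cauchySeq_tendsto_of_complete (hc.cauchySeq (mem_univ u))
  choose g hg using hp
  exact ⟨g, tendstoUniformlyOn_univ.1 (hc.tendstoUniformlyOn_of_tendsto fun u _ => hg u)⟩

variable {Φ : Torus → Torus} (hΦ : TendstoUniformly (D.Phi α δ) Φ atTop)
include hΦ

lemma Admissible.continuous_limit : Continuous Φ :=
  hΦ.continuous (Eventually.of_forall fun n => h.tame.continuous_Phi hα n).frequently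

omit hα h in
lemma limit_fst (u : Torus) : (Φ u).1 = u.1 := by
  have h1 := (continuous_fst.tendsto (Φ u)).comp (hΦ.tendsto_at u)
  refine tendsto_nhds_unique h1 ?_
  simp only [Function.comp_def, Phi_fst]
  exact tendsto_const_nhds

lemma Admissible.limit_surjective : Function.Surjective Φ := by
  intro w
  have hcl : IsClosed (range Φ) := isCompact_range (h.continuous_limit hα hΦ) |>.isClosed
  choose u hu using fun n => h.tame.Phi_surjective hα n w
  suffices w ∈ closure (range Φ) by rwa [hcl.closure_eq] at this
  rw [Metric.mem_closure_iff]
  intro e he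
  obtain ⟨n, hn⟩ := (Metric.tendstoUniformly_iff.1 hΦ e he).exists
  refine ⟨Φ (u n), mem_range_self _, ?_⟩
  have := hn (u n)
  rwa [hu, dist_comm] at this

omit hα in
lemma Admissible.limit_z {m n : ℕ} (hm : m ≤ n) {u : Torus} (hu : D.Phi α δ n u = D.z m) :
    Φ u = D.z m := by
  refine tendsto_nhds_unique (hΦ.tendsto_at u) ?_
  refine tendsto_const_nhds.congr' ?_
  filter_upwards [eventually_ge_atTop n] with k hk
  exact (h.tame.Phi_z_of_le hm hk hu).symm

/-- If the images of distinct points never meet at a finite stage, their distance stays above a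
positive constant: the infinite product times the distance at a stage `n + 1` with `1 / (n + 1)`
below the initial distance. -/
lemma Admissible.limit_eq {u v : Torus} (huv : Φ u = Φ v) : u = v ∨ ∃ m, Φ u = D.z m := by
  by_contra! hne
  obtain ⟨a, ha2, ⟨C, hC, hCa⟩, ha⟩ := h.expand
  have hd : 0 < torusDist u v :=
    (torusDist_nonneg _ _).lt_of_ne fun h0 => hne.1 (torusDist_eq_zero h0.symm)
  obtain ⟨n, hn⟩ := exists_nat_one_div_lt hd
  have hdn : 0 < torusDist (D.Phi α δ (n + 1) u) (D.Phi α δ (n + 1) v) := by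
    refine (torusDist_nonneg _ _).lt_of_ne fun h0 => ?_
    rcases h.tame.Phi_eq hα (torusDist_eq_zero h0.symm) with h1 | ⟨m, hm, h1⟩
    · exact hne.1 h1
    · exact hne.2 m (h.limit_z hΦ hm h1)
  have hf : ∀ r, 0 < 1 - 1 / (a r : ℝ) ∧ 1 - 1 / (a r : ℝ) ≤ 1 := by
    intro r
    have : (2 : ℝ) ≤ a r := by exact_mod_cast ha2 r
    have h1 : 1 / (a r : ℝ) ≤ 1 / 2 := one_div_le_one_div_of_le two_pos this
    have h2 : 0 ≤ 1 / (a r : ℝ) := by positivity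
    constructor <;> linarith
  have key : ∀ m > n + 1, (∏ r ∈ Finset.Icc 1 m, (1 - 1 / (a r : ℝ))) *
      torusDist (D.Phi α δ (n + 1) u) (D.Phi α δ (n + 1) v) ≤
      torusDist (D.Phi α δ m u) (D.Phi α δ m v) := by
    intro m hm
    refine le_trans ?_ (ha (n + 1) m (by omega) hm u v (by exact_mod_cast hn.le))
    refine mul_le_mul_of_nonneg_right ?_ (torusDist_nonneg _ _)
    -- All factors are at most 1, so including the earlier ones only lowers the bound.
    exact Finset.prod_le_prod_of_subset_of_le_one (Finset.Icc_subset_Icc_left (by omega))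
      (fun r _ => (hf r).1.le) fun r _ _ => (hf r).2
  have lim1 := hCa.mul_const (torusDist (D.Phi α δ (n + 1) u) (D.Phi α δ (n + 1) v))
  have lim2 := (continuous_torusDist.tendsto (Φ u, Φ v)).comp
    ((hΦ.tendsto_at u).prodMk_nhds (hΦ.tendsto_at v))
  have := le_of_tendsto_of_tendsto lim1 lim2 ((eventually_gt_atTop (n + 1)).mono key)
  simp only [huv, torusDist_self] at this
  linarith [mul_pos hC hdn]

lemma Admissible.limit_bijOn : BijOn Φ D.X D.X := by
  refine ⟨fun u hu => (D.mem_X_congr (limit_fst hΦ u)).2 hu, fun u hu v _ huv => ?_, fun w hw => ?_⟩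
  · refine (h.limit_eq hα hΦ huv).resolve_right ?_
    rintro ⟨m, hm⟩
    exact hu m (by rw [← limit_fst hΦ u, hm])
  · obtain ⟨u, rfl⟩ := h.limit_surjective hα hΦ w
    exact ⟨u, (D.mem_X_congr (limit_fst hΦ u)).1 hw, rfl⟩

/-- Two points collapsed by the n-th map to `z n` are pulled back through the surjective earlier
product, and later maps fix `z n`. -/
lemma Admissible.existsUnique_limit_iff (w : Torus) : (∃! u, Φ u = w) ↔ ∀ n, w ≠ D.z n := by
  constructor
  · rintro ⟨u₀, -, hu⟩ n rfl
    obtain ⟨u, v, huv, hu1, hv1⟩ := D.exists_Lam_eq_z hα (h.pos n) (h.tame.lt_half n)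
    obtain ⟨u', v', huv', hu', hv'⟩ : ∃ u' v', u' ≠ v' ∧ D.Phi α δ n u' = D.z n ∧
        D.Phi α δ n v' = D.z n := by
      cases n with
      | zero => exact ⟨u, v, huv, hu1, hv1⟩
      | succ n =>
        obtain ⟨u', rfl⟩ := h.tame.Phi_surjective (D := D) hα n u
        obtain ⟨v', rfl⟩ := h.tame.Phi_surjective (D := D) hα n v
        exact ⟨u', v', fun h => huv (by rw [h]), hu1, hv1⟩
    exact huv' ((hu _ (h.limit_z hΦ le_rfl hu')).trans (hu _ (h.limit_z hΦ le_rfl hv')).symm)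
  · intro hw
    obtain ⟨u, rfl⟩ := h.limit_surjective hα hΦ w
    refine ⟨u, rfl, fun v hv => ((h.limit_eq hα hΦ hv.symm).resolve_right ?_).symm⟩
    rintro ⟨m, hm⟩
    exact hw m hm

/-- The conjugated maps have a continuous limit, which `Φ` semiconjugates to `R`. -/
lemma Admissible.exists_lift {π : ℕ → ℕ} {R : Torus → Torus} {c : Torus} (hR : D.IsShift π R c)
    {s : ℕ} (hπ : D.IsZigzag α δ π s) (hcau : UniformCauchySeqOn (D.GamPerm α δ π R) atTop D.X) :
    ∃ S : Torus → Torus, Continuous S ∧ ∀ u, Φ (S u) = R (Φ u) := by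
  obtain ⟨S, hS, hlim⟩ := exists_continuous_limit D.dense_X
    (h.tame.exists_tendsto_GamPerm hα hR) hcau
  have hΦc := h.continuous_limit hα hΦ
  refine ⟨S, hS, fun u => ?_⟩
  refine congrFun (Continuous.ext_on D.dense_X (hΦc.comp hS) (hR.continuous.comp hΦc) ?_) u
  intro u hu
  have t0 : ∀ b, Tendsto (fun j : ℕ => 2 * j + s + b) atTop atTop := fun b =>
    tendsto_atTop_mono (fun j => by simp only [id]; omega) tendsto_id
  -- Along the indices `2 * j + s + 1` the reordered product may be replaced by `Phi (2 * j + s)`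
  -- with an error of at most `2 * δ (2 * j + s + 2)`.
  have l1 : Tendsto (fun j => D.Phi α δ (2 * j + s) (D.GamPerm α δ π R (2 * j + s + 1) u)) atTop
      (𝓝 (Φ (S u))) := by
    have : TendstoUniformly (fun j => D.Phi α δ (2 * j + s)) Φ atTop :=
      fun v hv => (t0 0).eventually (hΦ v hv)
    exact this.tendsto_comp hΦc.continuousAt ((hlim u hu).comp (t0 1))
  have l2 : Tendsto (fun j => R (D.Phi α δ (2 * j + s + 1) u)) atTop (𝓝 (R (Φ u))) :=
    (hR.continuous.tendsto _).comp ((hΦ.tendsto_at u).comp (t0 1))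
  refine tendsto_nhds_unique (l1.congr_dist ?_) l2
  refine squeeze_zero (fun _ => dist_nonneg) (g := fun j => 2 * δ (2 * j + s + 2)) ?_ ?_
  · intro j
    rw [← (h.tame.GamPerm_spec hα hR hu).2, h.tame.PhiPerm_zigzag hα hπ, dist_comm]
    exact D.dist_Lam_le hα (h.pos _) (h.tame.lt_half _) _
  · simpa using (h.tendsto_zero.comp (t0 2)).const_mul 2

/-- Both composites of the two lifts cover the identity through Φ, so they fix the dense set `X`, on
which Φ is injective. -/
lemma Admissible.exists_homeo : ∃ S : Torus ≃ₜ Torus, ∀ u, Φ (S u) = D.T (Φ u) := by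
  obtain ⟨S, hS, hS1⟩ := h.exists_lift hα hΦ D.isShift_sigma (h.tame.isZigzag_sigma hα) h.gam_cauchy
  obtain ⟨S', hS', hS1'⟩ := h.exists_lift hα hΦ D.isShift_tau (h.tame.isZigzag_tau hα) h.del_cauchy
  have key : ∀ f : Torus → Torus, Continuous f → (∀ u, Φ (f u) = Φ u) → ∀ u, f u = u := by
    intro f hf hfΦ u
    refine congrFun (Continuous.ext_on D.dense_X hf continuous_id fun u hu => ?_) u
    refine (h.limit_bijOn hα hΦ).injOn ?_ hu (hfΦ u)
    rw [D.mem_X_congr (v := u)]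
    · exact hu
    · rw [← limit_fst hΦ, hfΦ, limit_fst hΦ]
  exact ⟨⟨⟨S, S', key _ (hS'.comp hS) fun u => by simp [hS1', hS1],
    key _ (hS.comp hS') fun u => by simp [hS1', hS1]⟩, hS, hS'⟩, hS1⟩

lemma Admissible.extends_iff {S : Torus → Torus} :
    D.Extends Φ S ↔ ∀ u ∈ D.X, S u ∈ D.X ∧ Φ (S u) = D.T (Φ u) := by
  have hb := h.limit_bijOn hα hΦ
  refine forall₂_congr fun u hu => ?_
  have hT : D.T (Φ u) ∈ D.X := D.isShift_sigma.mem_X.2 (hb.mapsTo hu)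
  have h1 := Function.invFunOn_mem (hb.surjOn hT)
  have h2 := Function.invFunOn_eq (hb.surjOn hT)
  constructor
  · intro h; rw [h]; exact ⟨h1, h2⟩
  · rintro ⟨h3, h4⟩
    exact hb.injOn h3 h1 (h4.trans h2.symm)

/-- The image of an orbit closure is closed and contains a dense orbit of the rotation, so it is
everything. Points of `X` are alone in their Φ-fibres, so the closure contains `X`. -/
lemma Admissible.isMinimalHomeo {S : Torus ≃ₜ Torus} (hS : ∀ u, Φ (S u) = D.T (Φ u)) :
    IsMinimalHomeo S := by
  intro p
  have hz : ∀ (n : ℤ) (p : Torus), Φ ((S ^ n) p) = (D.T ^ n) (Φ p) := by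
    intro n
    induction n with
    | zero => intro p; rfl
    | succ n ih =>
      intro p
      rw [zpow_add_one, zpow_add_one, Homeomorph.mul_apply, Homeomorph.mul_apply, ih, hS]
    | pred n ih =>
      intro p
      rw [zpow_sub_one, zpow_sub_one, Homeomorph.mul_apply, Homeomorph.mul_apply, ih]
      congr 1
      rw [← D.T.symm_apply_apply (Φ (S⁻¹ p)), ← hS]
      change D.T.symm (Φ (S (S.symm p))) = _
      rw [S.apply_symm_apply]
      rfl
  have hΦc := h.continuous_limit hα hΦ
  have him : Φ '' closure (range fun n : ℤ => (S ^ n) p) = univ := by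
    have hcl : IsClosed (Φ '' closure (range fun n : ℤ => (S ^ n) p)) :=
      hΦc.isClosedMap _ isClosed_closure
    rw [← hcl.closure_eq]
    refine Dense.closure_eq ((D.minimal_rotation (Φ p)).mono ?_)
    rintro _ ⟨n, rfl⟩
    exact ⟨(S ^ n) p, subset_closure (mem_range_self n), hz n p⟩
  have hX : D.X ⊆ closure (range fun n : ℤ => (S ^ n) p) := by
    intro u hu
    obtain ⟨y, hy, hyu⟩ : Φ u ∈ Φ '' closure (range fun n : ℤ => (S ^ n) p) := by
      rw [him]; trivial
    rcases h.limit_eq hα hΦ hyu.symm with rfl | ⟨m, hm⟩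
    · exact hy
    · exact absurd (by rw [← limit_fst hΦ u, hm]) (hu m)
  have := D.dense_X.mono hX
  rwa [dense_closure] at this

end
end Choices

/-! ### Recursive construction of admissible sizes. -/

lemma torusDist_eq (p q : Torus) : torusDist p q = dist (WithLp.toLp 2 p) (WithLp.toLp 2 q) := by
  rw [WithLp.prod_dist_eq_of_L2]; rfl

lemma torusDist_triangle (p q r : Torus) : torusDist p r ≤ torusDist p q + torusDist q r := by
  simp only [torusDist_eq]; exact dist_triangle _ _ _

lemma torusDist_of_fst_eq {p q : Torus} (h : p.1 = q.1) : torusDist p q = dist p q := by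
  rw [torusDist, h, Prod.dist_eq, h, dist_self, max_eq_right dist_nonneg]
  simp [Real.sqrt_sq]

lemma dist_le_torusDist (p q : Torus) : dist p q ≤ torusDist p q := by
  refine max_le ?_ ?_
  · exact Real.le_sqrt_of_sq_le (le_add_of_nonneg_right (sq_nonneg _))
  · exact Real.le_sqrt_of_sq_le (le_add_of_nonneg_left (sq_nonneg _))

lemma torusDist_le (p q : Torus) : torusDist p q ≤ 2 * dist p q := by
  have h1 : dist p.1 q.1 ≤ dist p q := le_max_left _ _
  have h2 : dist p.2 q.2 ≤ dist p q := le_max_right _ _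
  refine Real.sqrt_le_iff.2 ⟨by positivity, ?_⟩
  nlinarith [dist_nonneg (x := p.1) (y := q.1), dist_nonneg (x := p.2) (y := q.2)]

/-- Recursive choice of a sequence, each term subject to a condition on its predecessors. -/
lemma exists_seq_of_forall_exists {G : ℝ → Prop} {P : (ℕ → ℝ) → ℕ → ℝ → Prop} {x : ℝ} (hx : G x)
    (H : ∀ δ, (∀ n, G (δ n)) → ∀ r, ∃ d, G d ∧ P δ r d)
    (hP : ∀ δ δ' r d, (∀ m < r, δ m = δ' m) → P δ r d → P δ' r d) :
    ∃ δ : ℕ → ℝ, (∀ n, G (δ n)) ∧ ∀ r, P δ r (δ r) := by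
  choose! next hG hnext using H
  -- `f r` holds the first `r` chosen terms, padded by `x`. The padding satisfies `G`, and by `hP`
  -- it does not affect the conditions.
  let f : ℕ → ℕ → ℝ := fun n => Nat.rec (fun _ => x) (fun r δ => Function.update δ r (next δ r)) n
  have hf : ∀ r, f (r + 1) = Function.update (f r) r (next (f r) r) := fun r => rfl
  have hfG : ∀ r n, G (f r n) := by
    intro r
    induction r with
    | zero => exact fun _ => hx
    | succ r ih =>
      intro n
      rw [hf]
      rcases eq_or_ne n r with rfl | h
      · rw [Function.update_self]; exact hG _ ih _
      · rw [Function.update_of_ne h]; exact ih n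
  have hst : ∀ m s, m + 1 ≤ s → f s m = f (m + 1) m := by
    intro m s hs
    induction s, hs using Nat.le_induction with
    | base => rfl
    | succ s hs ih => rw [hf, Function.update_of_ne (by omega), ih]
  refine ⟨fun n => f (n + 1) n, fun n => hfG (n + 1) n, fun r => ?_⟩
  have := hnext (f r) (hfG r) r
  have h2 : f (r + 1) r = next (f r) r := by rw [hf, Function.update_self]
  rw [← h2] at this
  exact hP _ _ _ _ (fun m hm => hst m r hm) this

namespace Choices
variable {D : Choices} {α : ℕ → ℝ}

lemma Lam_congr {δ δ' : ℕ → ℝ} {n : ℕ} (h : δ n = δ' n) : D.Lam α δ n = D.Lam α δ' n := by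
  funext u
  have hA : D.A δ n = D.A δ' n := by simp only [A, h]
  by_cases hu : u ∈ D.A δ n
  · have hu' : u ∈ D.A δ' n := hA ▸ hu
    simp only [Lam, hu, hu', h]
  · rw [D.Lam_of_notMem hu, D.Lam_of_notMem (hA ▸ hu)]

lemma Phi_congr {δ δ' : ℕ → ℝ} {n : ℕ} (h : ∀ m ≤ n, δ m = δ' m) : D.Phi α δ n = D.Phi α δ' n :=
  iter_congr fun k hk => Lam_congr (h k hk)

/-- The conditions on the size `d` of the square `A_r`, when the earlier squares have the sizes
`δ_0, …, δ_{r-1}`. -/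
structure Next (D : Choices) (α δ : ℕ → ℝ) (r : ℕ) (d : ℝ) : Prop where
  lt_pow : d < 1 / 2 ^ r
  sep : ∀ k ∈ Finset.Icc 1 5, 2 * d < dist (D.z r).1 (D.z (r + k)).1
  le : ∀ m < r, d ≤ δ m
  lt_dist : ∀ m < r, d < dist (D.z m).1 (D.z r).1 / r
  fibre : ∀ n, r = n + 1 → ∀ v w : UnitAddCircle,
    torusDist (D.Phi α δ n ((D.z r).1, v)) (D.Phi α δ n ((D.z r).1, w)) ≤ d →
      dist v w < 1 / ((n + 1 : ℕ) : ℝ)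
  -- The factor is `4 * K + 1` with `K = (r + 1) ^ 2`, where `1 - 1 / K` is the contraction allowed
  -- at step `r`: a point within `4 * K * d` of the square lies within `(4 * K + 1) * d` of its
  -- centre.
  small : ∀ k < r, ∀ j ≤ r + 2, k < j → ∀ u v : Torus,
    dist (D.Phi α δ k u) (D.z j) ≤ (4 * (r + 1) ^ 2 + 1) * d →
      dist (D.Phi α δ k v) (D.z j) ≤ (4 * (r + 1) ^ 2 + 1) * d → dist u v < 1 / 2 ^ r

lemma Next.congr {δ δ' : ℕ → ℝ} {r : ℕ} {d : ℝ} (h : ∀ m < r, δ m = δ' m)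
    (hn : D.Next α δ r d) : D.Next α δ' r d := by
  have hΦ : ∀ k < r, D.Phi α δ k = D.Phi α δ' k := fun k hk =>
    Phi_congr fun m hm => h m (by omega)
  refine ⟨hn.lt_pow, hn.sep, fun m hm => h m hm ▸ hn.le m hm, hn.lt_dist, ?_, ?_⟩
  · intro n hr
    rw [← hΦ n (by omega)]
    exact hn.fibre n hr
  · intro k hk
    rw [← hΦ k hk]
    exact hn.small k hk

lemma eventually_lt_of_pos {c : ℝ} (hc : 0 < c) : ∀ᶠ d : ℝ in 𝓝[>] 0, d < c :=
  nhdsWithin_le_nhds (gt_mem_nhds hc)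

lemma eventually_mul_lt_of_pos {K c : ℝ} (hK : 0 < K) (hc : 0 < c) :
    ∀ᶠ d : ℝ in 𝓝[>] 0, K * d < c :=
  (eventually_lt_of_pos (div_pos hc hK)).mono fun d hd => by
    rw [lt_div_iff₀ hK] at hd; linarith

variable (hα : ∀ n, α n ∈ Icc (0 : ℝ) 1) {δ : ℕ → ℝ}
include hα

/-- Only the fibres of `z 0`, …, `z k` are singular for `Phi k`, so `z j` has a single preimage. -/
lemma SmallSquares.eventually_small (hδ : SmallSquares δ) {k j : ℕ} (hkj : k < j) {K e : ℝ} (hK : 0 < K)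
    (he : 0 < e) : ∀ᶠ d in 𝓝[>] (0 : ℝ), ∀ u v : Torus, dist (D.Phi α δ k u) (D.z j) ≤ K * d →
      dist (D.Phi α δ k v) (D.z j) ≤ K * d → dist u v < e := by
  obtain ⟨y, hy⟩ := hδ.Phi_surjective (D := D) hα k (D.z j)
  have hu : ∀ u, D.Phi α δ k u = D.Phi α δ k y → u = y := by
    intro u hu
    refine (hδ.PhiPerm_eq (π := id) hα hu).resolve_right ?_
    rintro ⟨m, hm, h⟩
    have := congrArg Prod.fst hu
    rw [hy, D.Phi_fst, h] at this
    exact D.z_fst_ne (by simp only [id]; omega) this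
  obtain ⟨r, hr, hrd⟩ := exists_dist_lt_of_unique (hδ.continuous_Phi hα k) hu (half_pos he)
  rw [hy] at hrd
  filter_upwards [eventually_mul_lt_of_pos hK hr] with d hd u v h1 h2
  linarith [hrd u (h1.trans_lt hd), hrd v (h2.trans_lt hd), dist_triangle_right u v y]

/-- `Phi n` is injective on the fibre of `z (n + 1)`, so on the compact set of pairs at distance at
least `e` the image distance has a positive lower bound. -/
lemma SmallSquares.eventually_fibre (hδ : SmallSquares δ) (n : ℕ) {e : ℝ} (he : 0 < e) :
    ∀ᶠ d in 𝓝[>] (0 : ℝ), ∀ v w : UnitAddCircle,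
    torusDist (D.Phi α δ n ((D.z (n + 1)).1, v)) (D.Phi α δ n ((D.z (n + 1)).1, w)) ≤ d →
      dist v w < e := by
  have hK : IsCompact {q : UnitAddCircle × UnitAddCircle | e ≤ dist q.1 q.2} :=
    (isClosed_le continuous_const (by fun_prop)).isCompact
  have hΦ := hδ.continuous_Phi (D := D) hα n
  have hc : Continuous fun q : UnitAddCircle × UnitAddCircle =>
      torusDist (D.Phi α δ n ((D.z (n + 1)).1, q.1)) (D.Phi α δ n ((D.z (n + 1)).1, q.2)) :=
    continuous_torusDist.comp (f := fun q : UnitAddCircle × UnitAddCircle =>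
      (D.Phi α δ n ((D.z (n + 1)).1, q.1), D.Phi α δ n ((D.z (n + 1)).1, q.2)))
      ((hΦ.comp (by fun_prop)).prodMk (hΦ.comp (by fun_prop)))
  obtain ⟨c, hc0, hcl⟩ := hK.exists_forall_le' hc.continuousOn (a := 0) (by
    rintro ⟨v, w⟩ hvw
    refine (torusDist_nonneg _ _).lt_of_ne fun h0 => ?_
    rcases hδ.PhiPerm_eq (π := id) hα (torusDist_eq_zero h0.symm) with h | ⟨k, hk, h⟩
    · have : v = w := congrArg Prod.snd h
      have h2 : e ≤ dist v w := hvw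
      rw [this, dist_self] at h2
      linarith
    · exact D.z_fst_ne (by simp only [id]; omega) h)
  filter_upwards [eventually_lt_of_pos hc0] with d hd v w h
  by_contra! hvw
  linarith [hcl (v, w) hvw]

lemma SmallSquares.exists_next (hδ : SmallSquares δ) (r : ℕ) :
    ∃ d, (0 < d ∧ d < 1 / 2) ∧ D.Next α δ r d := by
  have hpos : ∀ {m n : ℕ}, m ≠ n → 0 < dist (D.z m).1 (D.z n).1 := fun h =>
    dist_pos.2 (D.z_fst_ne h)
  have e1 : ∀ᶠ d : ℝ in 𝓝[>] 0, ∀ k ∈ Finset.Icc 1 5, 2 * d < dist (D.z r).1 (D.z (r + k)).1 := by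
    refine (eventually_all_finset _).2 fun k hk => eventually_mul_lt_of_pos two_pos (hpos ?_)
    have := (Finset.mem_Icc.1 hk).1
    omega
  have e2 : ∀ᶠ d : ℝ in 𝓝[>] 0, ∀ m < r, d ≤ δ m :=
    (eventually_all_finite (finite_lt_nat r)).2 fun m _ =>
      (eventually_lt_of_pos (hδ.pos m)).mono fun _ => le_of_lt
  have e3 : ∀ᶠ d : ℝ in 𝓝[>] 0, ∀ m < r, d < dist (D.z m).1 (D.z r).1 / r := by
    refine (eventually_all_finite (finite_lt_nat r)).2 fun m hm => eventually_lt_of_pos ?_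
    have hm : m < r := hm
    exact div_pos (hpos hm.ne) (by exact_mod_cast Nat.zero_lt_of_lt hm)
  have e4 : ∀ᶠ d : ℝ in 𝓝[>] 0, ∀ n, r = n + 1 → ∀ v w : UnitAddCircle,
      torusDist (D.Phi α δ n ((D.z r).1, v)) (D.Phi α δ n ((D.z r).1, w)) ≤ d →
      dist v w < 1 / ((n + 1 : ℕ) : ℝ) := by
    cases r with
    | zero => exact Eventually.of_forall fun d n hn => by omega
    | succ r =>
      refine (hδ.eventually_fibre (D := D) hα r (e := 1 / ((r + 1 : ℕ) : ℝ))
        (by positivity)).mono fun d hd n hn => ?_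
      obtain rfl : r = n := by omega
      exact hd
  have e5 : ∀ᶠ d : ℝ in 𝓝[>] 0, ∀ k < r, ∀ j ≤ r + 2, k < j → ∀ u v : Torus,
      dist (D.Phi α δ k u) (D.z j) ≤ (4 * (r + 1) ^ 2 + 1) * d →
      dist (D.Phi α δ k v) (D.z j) ≤ (4 * (r + 1) ^ 2 + 1) * d → dist u v < 1 / 2 ^ r := by
    refine (eventually_all_finite (finite_lt_nat r)).2 fun k _ =>
      (eventually_all_finite (finite_le_nat (r + 2))).2 fun j _ => ?_
    by_cases hkj : k < j
    · exact (hδ.eventually_small hα hkj (K := 4 * ((r : ℝ) + 1) ^ 2 + 1)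
        (e := 1 / 2 ^ r) (by positivity) (by positivity)).mono fun d hd _ => hd
    · exact Eventually.of_forall fun d h => absurd h hkj
  have e6 : ∀ᶠ d : ℝ in 𝓝[>] 0, d < 1 / 2 ^ r := eventually_lt_of_pos (by positivity)
  have e7 : ∀ᶠ d : ℝ in 𝓝[>] 0, d < 1 / 2 := eventually_lt_of_pos (by positivity)
  obtain ⟨d, h0, h1, h2, h3, h4, h5, h6, h7⟩ := (eventually_mem_nhdsWithin.and (e1.and (e2.and
    (e3.and (e4.and (e5.and (e6.and e7))))))).exists
  exact ⟨d, ⟨h0, h7⟩, h6, h1, h2, h3, h4, h5⟩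

omit hα in
lemma fine_of_next (hδ : SmallSquares δ) (hN : ∀ r, D.Next α δ r (δ r)) : D.Fine α δ where
  toSmallSquares := hδ
  anti := antitone_nat_of_succ_le fun n => (hN (n + 1)).le n (Nat.lt_succ_self n)
  disjoint m n h1 h2 := by
    rw [disjoint_left]
    intro u hm hn
    have a1 := (D.mem_A.1 hm).1
    have a2 := (D.mem_A.1 hn).1
    rw [← dist_eq_norm] at a1 a2
    have a3 := (hN m).sep (n - m) (Finset.mem_Icc.2 ⟨by omega, by omega⟩)
    rw [Nat.add_sub_cancel' h1.le] at a3
    linarith [(hN n).le m h1, dist_triangle_left (D.z m).1 (D.z n).1 u.1]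
  avoid m n h u hu h' := by
    have a1 := (D.mem_A.1 hu).1
    rw [← dist_eq_norm, h'] at a1
    have a2 := (hN n).lt_dist m h
    have a3 : dist (D.z m).1 (D.z n).1 / n ≤ dist (D.z m).1 (D.z n).1 :=
      div_le_self dist_nonneg (by exact_mod_cast Nat.one_le_of_lt h)
    linarith
  sep n := (hN n).sep 2 (by simp)
  small r k j h1 h2 h3 u v hu hv := by
    have : δ r ≤ (4 * ((r : ℝ) + 1) ^ 2 + 1) * δ r :=
      le_mul_of_one_le_left (hδ.pos r).le (by linarith [sq_nonneg ((r : ℝ) + 1)])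
    exact (hN r).small k h1 j h3 h2 u v (hu.trans this) (hv.trans this)

/-- The step from `Φ_n` to `Φ_{n+1}` hardly decreases the distance of images of remote points. -/
lemma SmallSquares.expand_succ (hδ : SmallSquares δ) (hN : ∀ r, D.Next α δ r (δ r)) {n : ℕ} (hn : 1 ≤ n)
    {u v : Torus} (huv : 1 / (n : ℝ) ≤ torusDist u v) :
    (1 - 1 / ((n + 1 : ℕ) + 1 : ℝ) ^ 2) * torusDist (D.Phi α δ n u) (D.Phi α δ n v) ≤
      torusDist (D.Phi α δ (n + 1) u) (D.Phi α δ (n + 1) v) := by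
  change _ ≤ torusDist (D.Lam α δ (n + 1) (D.Phi α δ n u)) (D.Lam α δ (n + 1) (D.Phi α δ n v))
  set p := D.Phi α δ n u with hp
  set q := D.Phi α δ n v with hq
  set K : ℝ := ((n + 1 : ℕ) + 1 : ℝ) ^ 2 with hK
  have hK0 : 0 < K := by positivity
  have hdist : ∀ w, torusDist (D.Lam α δ (n + 1) w) w ≤ 2 * δ (n + 1) := fun w => by
    rw [torusDist_of_fst_eq (D.Lam_fst _ _ _)]
    exact D.dist_Lam_le hα (hδ.pos _) (hδ.lt_half _) w
  have hsymm : ∀ a b : Torus, torusDist a b = torusDist b a := fun a b => by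
    simp only [torusDist, dist_comm]
  have hnn := torusDist_nonneg p q
  -- Each image moves by at most `2 * δ (n + 1)`, which is harmless if the images are far apart on
  -- this scale. Otherwise, if one of them were in the square, both would be near its centre, which
  -- would force `u` and `v` closer than `1 / n`; so neither image moves.
  by_cases h1 : 4 * δ (n + 1) ≤ 1 / K * torusDist p q
  · have t1 := torusDist_triangle p (D.Lam α δ (n + 1) p) q
    have t2 := torusDist_triangle (D.Lam α δ (n + 1) p) (D.Lam α δ (n + 1) q) q
    have t3 := hdist p
    have t4 := hdist q
    rw [hsymm] at t3
    linarith
  · have h2 : torusDist p q < 4 * K * δ (n + 1) := by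
      rw [not_le, div_mul_eq_mul_div, one_mul, div_lt_iff₀ hK0] at h1
      linarith
    have hbound : ∀ a b : Torus, torusDist a b < 4 * K * δ (n + 1) → a ∈ D.A δ (n + 1) →
        dist a (D.z (n + 1)) ≤ (4 * K + 1) * δ (n + 1) ∧
        dist b (D.z (n + 1)) ≤ (4 * K + 1) * δ (n + 1) := by
      intro a b hab ha
      rw [A_eq, Metric.mem_closedBall] at ha
      have b1 := dist_triangle_left b (D.z (n + 1)) a
      have b2 := dist_le_torusDist a b
      have b3 : 0 < 4 * K * δ (n + 1) := mul_pos (by positivity) (hδ.pos _)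
      constructor <;> linarith
    have hfar : ¬ (dist p (D.z (n + 1)) ≤ (4 * K + 1) * δ (n + 1) ∧
        dist q (D.z (n + 1)) ≤ (4 * K + 1) * δ (n + 1)) := by
      rintro ⟨h3, h4⟩
      have h5 := (hN (n + 1)).small n (Nat.lt_succ_self n) (n + 1) (by omega)
        (Nat.lt_succ_self n) u v h3 h4
      have h6 := torusDist_le u v
      have h7 : (1 : ℝ) / 2 ^ (n + 1) * 2 = 1 / 2 ^ n := by rw [pow_succ]; field_simp
      have h8 : (1 : ℝ) / 2 ^ n ≤ 1 / n :=
        one_div_le_one_div_of_le (by exact_mod_cast hn) (by exact_mod_cast Nat.lt_two_pow_self.le)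
      linarith
    have hp' : p ∉ D.A δ (n + 1) := fun h => hfar (hbound p q h2 h)
    have hq' : q ∉ D.A δ (n + 1) := fun h => hfar (hbound q p (by rwa [hsymm]) h).symm
    rw [D.Lam_of_notMem hp', D.Lam_of_notMem hq']
    have : 0 ≤ 1 / K * torusDist p q := by positivity
    linarith

lemma SmallSquares.expand (hδ : SmallSquares δ) (hN : ∀ r, D.Next α δ r (δ r)) {n m : ℕ} (hn : 1 ≤ n)
    (hm : n ≤ m) {u v : Torus} (huv : 1 / (n : ℝ) ≤ torusDist u v) :
    (∏ r ∈ Finset.Icc (n + 1) m, (1 - 1 / ((r : ℝ) + 1) ^ 2)) *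
        torusDist (D.Phi α δ n u) (D.Phi α δ n v) ≤
      torusDist (D.Phi α δ m u) (D.Phi α δ m v) := by
  induction m, hm using Nat.le_induction with
  | base => simp
  | succ m hm ih =>
    rw [Finset.prod_Icc_succ_top (by omega), mul_comm (∏ r ∈ _, _), mul_assoc]
    have h1 : 1 / (m : ℝ) ≤ torusDist u v :=
      (one_div_le_one_div_of_le (by exact_mod_cast hn) (by exact_mod_cast hm)).trans huv
    refine le_trans (mul_le_mul_of_nonneg_left ih ?_) (hδ.expand_succ hα hN (hn.trans hm) h1)
    rw [sub_nonneg, div_le_one (by positivity)]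
    exact one_le_pow₀ (by linarith [(Nat.cast_nonneg (m + 1) : (0 : ℝ) ≤ _)])

omit hα in
-- The factors are `r (r + 2) / (r + 1) ^ 2`, so the product telescopes; its limit is `1/2`.
lemma prod_one_sub (N : ℕ) :
    ∏ r ∈ Finset.Icc 1 N, (1 - 1 / ((r : ℝ) + 1) ^ 2) = 1 / 2 + 1 / 2 * (1 / ((N : ℝ) + 1)) := by
  induction N with
  | zero => norm_num
  | succ N ih =>
    rw [Finset.prod_Icc_succ_top (by omega), ih]
    push_cast
    field_simp
    ring

lemma exists_admissible : ∃ δ : ℕ → ℝ, D.Admissible α δ := by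
  obtain ⟨δ, hG, hN⟩ := exists_seq_of_forall_exists (G := fun d => 0 < d ∧ d < 1 / 2)
    (P := D.Next α) (x := 1 / 4) (by norm_num)
    (fun δ hδ r => SmallSquares.exists_next hα ⟨fun n => (hδ n).1, fun n => (hδ n).2⟩ r)
    (fun δ δ' r d h => Next.congr h)
  have hδ : SmallSquares δ := ⟨fun n => (hG n).1, fun n => (hG n).2⟩
  have hF := fine_of_next hδ hN
  refine ⟨δ, hδ.pos, hF.disjoint, fun n => (hN n).lt_pow, hF.avoid,
    fun m n h => (hN n).lt_dist m h, fun n => (hN (n + 1)).fibre n rfl, ?_,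
    hF.uniformContinuousOn_GamPerm hα D.isShift_sigma,
    hF.uniformContinuousOn_GamPerm hα D.isShift_tau,
    hF.uniformCauchySeqOn_GamPerm hα D.isShift_sigma (hF.isZigzag_sigma hα),
    hF.uniformCauchySeqOn_GamPerm hα D.isShift_tau (hF.isZigzag_tau hα)⟩
  have ha : ∀ n N : ℕ, 1 ≤ n →
      ∏ r ∈ Finset.Icc n N, (1 - 1 / ((max 2 ((r + 1) ^ 2) : ℕ) : ℝ)) =
        ∏ r ∈ Finset.Icc n N, (1 - 1 / ((r : ℝ) + 1) ^ 2) := by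
    intro n N hn
    refine Finset.prod_congr rfl fun r hr => ?_
    have h1 := (Finset.mem_Icc.1 hr).1
    rw [max_eq_right (by nlinarith)]
    push_cast
    rfl
  -- The maximum matters only at `r = 0`, where the square is 1; the products start at `r = 1`.
  refine ⟨fun r => max 2 ((r + 1) ^ 2), fun n => le_max_left _ _, ⟨1 / 2, by norm_num, ?_⟩, ?_⟩
  · simp only [ha 1 _ le_rfl, prod_one_sub]
    have := ((tendsto_one_div_add_atTop_nhds_zero_nat (𝕜 := ℝ)).const_mul (1 / 2)).const_add (1 / 2)
    rwa [mul_zero, add_zero] at this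
  · intro n m hn hm u v huv
    simp only [ha (n + 1) m (by omega)]
    exact hδ.expand hα hN hn hm.le huv

end Choices

end TorusMinimal

end

open TorusMinimal
theorem mainTheorem6 (D : Choices) (α : ℕ → ℝ) (hα : ∀ n, α n ∈ Icc (0 : ℝ) 1) :
    (∃ δ : ℕ → ℝ, D.Admissible α δ) ∧
    ∀ δ : ℕ → ℝ, D.Admissible α δ →
      ∃ Φ : Torus → Torus,
        TendstoUniformly (D.Phi α δ) Φ atTop ∧
        Continuous Φ ∧ Function.Surjective Φ ∧ BijOn Φ D.X D.X ∧
        (∀ w : Torus, (∃! u, Φ u = w) ↔ ∀ n, w ≠ D.z n) ∧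
        ∃ S : Torus ≃ₜ Torus,
          D.Extends Φ S ∧
          (∀ g : Torus → Torus, Continuous g → D.Extends Φ g → g = S) ∧
          (∀ u, Φ (S u) = D.T (Φ u)) ∧
          IsMinimalHomeo S := by
  refine ⟨Choices.exists_admissible hα, fun δ h => ?_⟩
  obtain ⟨Φ, hΦ⟩ := h.exists_tendstoUniformly hα
  obtain ⟨S, hS⟩ := h.exists_homeo hα hΦ
  have hb := h.limit_bijOn hα hΦ
  have hE : D.Extends Φ S := (h.extends_iff hα hΦ).2 fun u hu =>
    ⟨(D.mem_X_congr (by rw [← Choices.limit_fst hΦ (S u), hS])).2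
      (D.isShift_sigma.mem_X.2 (hb.mapsTo hu)), hS u⟩
  refine ⟨Φ, hΦ, h.continuous_limit hα hΦ, h.limit_surjective hα hΦ, hb,
    h.existsUnique_limit_iff hα hΦ, S, hE, fun g hg hgE => ?_, hS, h.isMinimalHomeo hα hΦ hS⟩
  exact Continuous.ext_on D.dense_X hg S.continuous fun u hu => (hgE u hu).trans (hE u hu).symm
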